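/- Let $q$ be even and let $\mathcal{P}=\mathcal{Q}(4,q)$ be a non-singular (parabolic) quadric in $\mathrm{PG}(4,q)$ with nucleus $N$, i.e. $N\notin\mathcal{P}$ is the point all of whose lines meet $\mathcal{P}$ in exactly one point. Let $\pi$ be a singular hyperplane of $\mathcal{P}$ with vertex $P$, i.e. a solid meeting $\mathcal{P}$ in a cone with vertex $P$ over a non-singular conic lying in a plane of $\pi$ not through $P$. Let $\mathcal{P}'$ be obtained from $\mathcal{P}$ by switching in $\pi$, i.e. $\mathcal{P}'=(\mathcal{P}\setminus R)\cup R'$ for some sets $R,R'$ of points of $\pi$. A set of points of $\mathrm{PG}(4,q)$ is called a parabolic quasi-quadric if each hyperplane meets it in a number of points in which some hyperplane meets a non-singular quadric of $\mathrm{PG}(4,q)$ (that is, in $q^2+1$, $q^2+q+1$ or $q^2+2q+1$ points). A $k$-arc in a plane is a set of $k$ points of the plane, no three on a line; an oval is a $(q+1)$-arc; a truncated cone is a cone without its vertex; the bases of the cones below lie in planes of $\pi$ not through the vertex. If $\mathcal{P}'$ is a parabolic quasi-quadric with $|\mathcal{P}'|=|\mathcal{Q}(4,q)|$, then $\mathcal{P}'\cap\pi$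 is one of the following: 1. a cone with vertex $P$ and base an oval; 2. a cone with vertex $N$ and base an oval; 3. the union of a truncated cone with vertex $P$ and base a $q$-arc together with one line through $N$ disjoint from the truncated cone and different from $PN$; 4. the union of a truncated cone with vertex $N$ and base a $q$-arc together with one line through $P$ disjoint from the truncated cone and different from $PN$. Conversely, whenever $\mathcal{P}'\cap\pi$ is of one of these four forms, $\mathcal{P}'$ is a parabolic quasi-quadric with $|\mathcal{Q}(4,q)|$ points. -/

import Mathlib

open Module
open scoped LinearAlgebra.Projectivization

namespace QuasiPolar

variable {K V : Type*} [Field K] [AddCommGroup V] [Module K V]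

/-- The points of the projective space `ℙ K V` on the projective subspace defined by `U`.
A point, line, plane, solid is a linear subspace of dimension 1, 2, 3, 4 respectively. -/
def pts (U : Submodule K V) : Set (ℙ K V) := {x | x.submodule ≤ U}

/-- The points of the quadric with equation `Q = 0`. -/
def quadric (Q : QuadraticForm K V) : Set (ℙ K V) := {x | Q x.rep = 0}

/-- The quadric `Q = 0` is non-singular: it has no singular point, in any characteristic. -/
def Nonsingular (Q : QuadraticForm K V) : Prop :=
  ∀ v : V, v ≠ 0 → Q v = 0 → ∃ w : V, QuadraticMap.polar Q v w ≠ 0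

/-- `H` is a hyperplane. -/
def IsHyperplane (H : Submodule K V) : Prop := finrank K H + 1 = finrank K V

/-- A parabolic quasi-quadric in `PG(2n, q)`: a set of points each of whose hyperplane intersection
sizes is a hyperplane intersection size of a non-singular quadric of `PG(2n, q)`. -/
def IsParabolicQuasiQuadric (S : Set (ℙ K V)) : Prop :=
  Odd (finrank K V) ∧
    ∀ H : Submodule K V, IsHyperplane H →
      ∃ (Q : QuadraticForm K V) (H' : Submodule K V), Nonsingular Q ∧ IsHyperplane H' ∧
        (S ∩ pts H).ncard = (quadric Q ∩ pts H').ncard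

/-- `N` is a nucleus of `S`: it is not in `S` and all lines through `N` meet `S` in exactly one
point. -/
def IsNucleus (S : Set (ℙ K V)) (N : ℙ K V) : Prop :=
  N ∉ S ∧ ∀ l : Submodule K V, finrank K l = 2 → N ∈ pts l → (S ∩ pts l).ncard = 1

/-- The cone with vertex `P` and base `B`: the union of the lines `PX` with `X` in `B`
(used for nonempty `B` not containing `P`). -/
def cone (P : ℙ K V) (B : Set (ℙ K V)) : Set (ℙ K V) :=
  {x | ∃ b ∈ B, x ∈ pts (P.submodule ⊔ b.submodule)}

/-- The truncated cone: the cone with its vertex removed. -/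
def truncatedCone (P : ℙ K V) (B : Set (ℙ K V)) : Set (ℙ K V) := cone P B \ {P}

/-- `H` is a singular hyperplane with vertex `P` of the quadric `Q = 0` in `PG(4, q)`: a solid that
meets the quadric in a cone with vertex `P` over a non-singular conic in a plane of `H` not
through `P`. -/
def IsSingularSolid (Q : QuadraticForm K V) (H : Submodule K V) (P : ℙ K V) : Prop :=
  finrank K H = 4 ∧ P ∈ pts H ∧
    ∃ μ : Submodule K V, μ ≤ H ∧ finrank K μ = 3 ∧ P ∉ pts μ ∧
      Nonsingular (Q.comp μ.subtype) ∧ quadric Q ∩ pts H = cone P (quadric Q ∩ pts μ)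

/-- `S'` is obtained from `S` by switching in `H`: a set `R` of points of `H` is replaced by a set
`R'` of points of `H`. -/
def IsSwitching (S : Set (ℙ K V)) (H : Submodule K V) (S' : Set (ℙ K V)) : Prop :=
  ∃ R R' : Set (ℙ K V), R ⊆ pts H ∧ R' ⊆ pts H ∧ S' = (S \ R) ∪ R'

/-- `A` is a `k`-arc in the plane `μ`: a set of `k` points of `μ`, no three on a line. -/
def IsArc (μ : Submodule K V) (k : ℕ) (A : Set (ℙ K V)) : Prop :=
  finrank K μ = 3 ∧ A ⊆ pts μ ∧ A.ncard = k ∧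
    ∀ l : Submodule K V, finrank K l = 2 → (A ∩ pts l).ncard ≤ 2

/-- `A` is an oval in the plane `μ`: a set of `q + 1` points meeting every line in 0, 1 or 2
points. -/
def IsOval (μ : Submodule K V) (A : Set (ℙ K V)) : Prop := IsArc μ (Nat.card K + 1) A

/-- `T` is a cone in the solid `H` with vertex `P` and base an oval, in a plane not through `P`. -/
def IsOvalCone (H : Submodule K V) (P : ℙ K V) (T : Set (ℙ K V)) : Prop :=
  ∃ (μ : Submodule K V) (O : Set (ℙ K V)), μ ≤ H ∧ P ∉ pts μ ∧ IsOval μ O ∧ T = cone P O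

/-- `T` is, in the solid `H`, the union of a truncated cone with vertex `P` and base a `q`-arc (in a
plane not through `P`) and a line `l` through `N`, disjoint from the truncated cone and different
from `PN`. -/
def IsTruncatedArcConeWithLine (H : Submodule K V) (P N : ℙ K V) (T : Set (ℙ K V)) : Prop :=
  ∃ (μ : Submodule K V) (A : Set (ℙ K V)) (l : Submodule K V),
    μ ≤ H ∧ P ∉ pts μ ∧ IsArc μ (Nat.card K) A ∧
    l ≤ H ∧ finrank K l = 2 ∧ N ∈ pts l ∧ l ≠ P.submodule ⊔ N.submodule ∧
    Disjoint (truncatedCone P A) (pts l) ∧ T = truncatedCone P A ∪ pts l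

end QuasiPolar

/-! Write `q` for the order of `K`, `p` and `n` for vectors spanning `P` and `N`. In characteristic
two, `H` is the kernel of the polar form at `p`, the nucleus spans the radical of the polar form,
and so `n` lies in `H`. Switching changes nothing off `H`, so a hyperplane `U ≠ H` sees the change
only through the plane `U ⊓ H`. Off `H`, the quadric has exactly `q ^ 2` points in `U` if `U`
contains `p` or `n`. Through a plane of `H` on neither point pass hyperplanes with `q ^ 2 - q` and
with `q ^ 2 + q` such points. Comparing with the allowed sizes, the hypothesis on `S` becomes a
condition on `T = S ∩ pts H` alone (`HasPlaneSizes`): `T` has `q ^ 2 + q + 1` points, every plane of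
`H` meets it in `1`, `q + 1` or `2q + 1` points, and planes missing `p` and `n` meet it in exactly
`q + 1`. This equivalence is `isParabolicQuasiQuadric_and_ncard_iff`. It is symmetric in `p` and
`n`, which pairs the four cases two by two.

For the classification, fix a plane `W` of `H` on the line `pn`. Counting along pencils shows that
all lines of `W` missing `p` and `n` have the same size. Hence, for `x` in `W` off `pn`, the
indicator of `x ∈ T` is a function of the line `px` plus a function of the line `nx`. A 0/1-valued
function of this form depends on one variable only, so off `pn` the set `T ∩ W` is ruled by lines
through `p` or by lines through `n` (`isRuledAt_or`). Over all `W`, this splits `T` off `pn` into a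
part `T₁` ruled from `p` and a part `T₂` ruled from `n`.

Let `A`, `B` be the sizes of `T₁`, `T₂` in a plane missing both points, and let `e` be 1 or 0
according as the point of that plane on `pn` is in `T` or not. Then `A + B + e = q + 1`. Planes
through just one of `p`, `n` give `B + [p ∈ T] ≡ 1` and `A + [n ∈ T] ≡ 1` modulo `q`, and the line
`pn` gives `[p ∈ T] + [n ∈ T] = 1 + e`. The only solutions are the four configurations. Bases are
arcs, since three collinear base points would produce a plane with at least `3q > 2q + 1` points of
`T`. -/

namespace QuasiPolar
-- Counting points through vectors, translates and pencils.
section Counting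

variable {K V : Type*} [Field K] [AddCommGroup V] [Module K V]

/-- The nonzero vectors spanning a point of `T`. -/
def hat (T : Set (ℙ K V)) : Set V := {v | ∃ hv : v ≠ 0, Projectivization.mk K v hv ∈ T}

theorem rep_mem_hat {T : Set (ℙ K V)} {X : ℙ K V} : X.rep ∈ hat T ↔ X ∈ T := by
  constructor
  · rintro ⟨h, hX⟩
    rwa [Projectivization.mk_rep] at hX
  · intro h
    exact ⟨X.rep_nonzero, by rwa [Projectivization.mk_rep]⟩

theorem mk_mem_iff {T : Set (ℙ K V)} {v : V} (hv : v ≠ 0) :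
    Projectivization.mk K v hv ∈ T ↔ v ∈ hat T :=
  ⟨fun h => ⟨hv, h⟩, fun ⟨_, h⟩ => h⟩

theorem ne_zero_of_mem_hat {T : Set (ℙ K V)} {v : V} (h : v ∈ hat T) : v ≠ 0 := h.1

theorem mk_mem_pts {v : V} (hv : v ≠ 0) {U : Submodule K V} :
    Projectivization.mk K v hv ∈ pts U ↔ v ∈ U := by
  simp [pts, Projectivization.submodule_mk]

theorem mem_pts_iff {X : ℙ K V} {U : Submodule K V} : X ∈ pts U ↔ X.rep ∈ U := by
  simp [pts, Projectivization.submodule_eq]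

theorem mem_hat_pts {v : V} {U : Submodule K V} : v ∈ hat (pts U) ↔ v ≠ 0 ∧ v ∈ U := by
  constructor
  · rintro ⟨h, h'⟩
    exact ⟨h, (mk_mem_pts h).1 h'⟩
  · rintro ⟨h, h'⟩
    exact ⟨h, (mk_mem_pts h).2 h'⟩

theorem mem_hat_inter {v : V} {S T : Set (ℙ K V)} : v ∈ hat (S ∩ T) ↔ v ∈ hat S ∧ v ∈ hat T := by
  constructor
  · rintro ⟨h, h'⟩
    exact ⟨⟨h, h'.1⟩, ⟨h, h'.2⟩⟩
  · rintro ⟨⟨h, h1⟩, ⟨_, h2⟩⟩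
    exact ⟨h, h1, h2⟩

theorem mem_hat_inter_pts {v : V} {T : Set (ℙ K V)} {U : Submodule K V} :
    v ∈ hat (T ∩ pts U) ↔ v ∈ hat T ∧ v ∈ U := by
  rw [mem_hat_inter, mem_hat_pts]
  exact ⟨fun h => ⟨h.1, h.2.2⟩, fun h => ⟨h.1, h.1.1, h.2⟩⟩

theorem hat_inter_pts (T : Set (ℙ K V)) (U : Submodule K V) :
    hat (T ∩ pts U) = hat T ∩ (U : Set V) := by
  ext v
  exact mem_hat_inter_pts

theorem smul_mem_hat {T : Set (ℙ K V)} {v : V} {c : K} (hc : c ≠ 0) :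
    c • v ∈ hat T ↔ v ∈ hat T := by
  have key : ∀ (c : K) (v : V), c ≠ 0 → v ∈ hat T → c • v ∈ hat T := by
    rintro c v hc ⟨hv, h⟩
    refine ⟨smul_ne_zero hc hv, ?_⟩
    have : Projectivization.mk K (c • v) (smul_ne_zero hc hv) = Projectivization.mk K v hv :=
      (Projectivization.mk_eq_mk_iff' K _ _ _ _).2 ⟨c, rfl⟩
    rwa [this]
  refine ⟨fun h => ?_, key c v hc⟩
  have := key c⁻¹ _ (inv_ne_zero hc) h
  rwa [smul_smul, inv_mul_cancel₀ hc, one_smul] at this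

theorem mem_hat_quadric {Q : QuadraticForm K V} {v : V} :
    v ∈ hat (quadric Q) ↔ v ≠ 0 ∧ Q v = 0 := by
  have key : ∀ hv : v ≠ 0, Projectivization.mk K v hv ∈ quadric Q ↔ Q v = 0 := by
    intro hv
    obtain ⟨a, ha⟩ := Projectivization.exists_smul_eq_mk_rep K v hv
    change Q (Projectivization.mk K v hv).rep = 0 ↔ _
    rw [← ha, Units.smul_def, QuadraticMap.map_smul]
    simp
  exact ⟨fun ⟨h, h'⟩ => ⟨h, (key h).1 h'⟩, fun ⟨h, h'⟩ => ⟨h, (key h).2 h'⟩⟩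

theorem set_eq_of_hat_eq {S T : Set (ℙ K V)} (h : ∀ v, v ∈ hat S ↔ v ∈ hat T) : S = T := by
  ext X
  rw [← rep_mem_hat, h, rep_mem_hat]

theorem one_lt_card_field [Finite K] : 1 < Nat.card K := Finite.one_lt_card

/-- Each point is spanned by `q - 1` nonzero vectors. Counts are made on vectors, where translation
by a fixed vector is available, and converted to points by this factor. -/
theorem ncard_hat (T : Set (ℙ K V)) : (hat T).ncard = (Nat.card K - 1) * T.ncard := by
  have h : hat T = (fun p : ℙ K V × Kˣ => (p.2 : K) • p.1.rep) '' (T ×ˢ Set.univ) := by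
    ext v
    constructor
    · rintro ⟨hv, h⟩
      obtain ⟨a, ha⟩ := Projectivization.exists_smul_eq_mk_rep K v hv
      refine ⟨(Projectivization.mk K v hv, a⁻¹), ⟨h, trivial⟩, ?_⟩
      simp only [← ha, Units.smul_def, smul_smul]
      simp
    · rintro ⟨⟨X, a⟩, ⟨hX, -⟩, rfl⟩
      exact (smul_mem_hat a.ne_zero).2 (rep_mem_hat.2 hX)
  have inj : Function.Injective (fun p : ℙ K V × Kˣ => (p.2 : K) • p.1.rep) := by
    rintro ⟨X, a⟩ ⟨Y, b⟩ hab
    simp only at hab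
    have hXY : X = Y := by
      rw [← X.mk_rep, ← Y.mk_rep]
      refine (Projectivization.mk_eq_mk_iff' K _ _ _ _).2 ⟨(a : K)⁻¹ * b, ?_⟩
      rw [mul_smul, ← hab, smul_smul, inv_mul_cancel₀ a.ne_zero, one_smul]
    subst hXY
    have := smul_left_injective K X.rep_nonzero hab
    simp [Units.ext_iff, this]
  rw [h, Set.ncard_image_of_injective _ inj, Set.ncard_prod, Set.ncard_univ, Nat.card_units,
    mul_comm]

/-- If `D` is a union of translates of the line spanned by `u`, each meeting `Z` in exactly one
vector, then `D` has `q` times as many vectors as `D ∩ Z`. -/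
theorem card_mul_ncard_of_translate [Finite V] {D Z : Set V} {u : V}
    (hD : ∀ v ∈ D, ∀ t : K, v + t • u ∈ D) (hZ : ∀ v ∈ D, ∃! t : K, v + t • u ∈ Z) :
    Nat.card K * (D ∩ Z).ncard = D.ncard := by
  have h : D = (fun p : K × V => p.2 + p.1 • u) '' (Set.univ ×ˢ (D ∩ Z)) := by
    ext v
    constructor
    · intro hv
      obtain ⟨t, ht, -⟩ := hZ v hv
      exact ⟨(-t, v + t • u), ⟨trivial, hD v hv t, ht⟩, by simp⟩
    · rintro ⟨⟨t, w⟩, ⟨-, hw, -⟩, rfl⟩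
      exact hD w hw t
  have inj : Set.InjOn (fun p : K × V => p.2 + p.1 • u) (Set.univ ×ˢ (D ∩ Z)) := by
    rintro ⟨t, v⟩ ⟨-, hv, hv'⟩ ⟨s, w⟩ ⟨-, hw, hw'⟩ hvw
    simp only at hvw hv hv' hw hw'
    have hw2 : w = v + (t - s) • u := by
      rw [sub_smul, ← add_sub_assoc, hvw, add_sub_cancel_right]
    have : t - s = 0 := (hZ v hv).unique (by rwa [← hw2]) (by simpa using hv')
    obtain rfl : t = s := sub_eq_zero.1 this
    simp at hw2
    simp [hw2]
  conv_rhs => rw [h]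
  rw [inj.ncard_image, Set.ncard_prod, Set.ncard_univ]

theorem ncard_submodule [Module.Finite K V] (U : Submodule K V) :
    (U : Set V).ncard = Nat.card K ^ finrank K U := by
  rw [← Module.natCard_eq_pow_finrank (K := K) (V := U)]
  rfl

theorem finite_of_finite_field [Finite K] [Module.Finite K V] : Finite V := Module.finite_of_finite K

theorem ncard_pts [Finite K] (U : Submodule K V) [Module.Finite K V] :
    (Nat.card K - 1) * (pts U).ncard + 1 = Nat.card K ^ finrank K U := by
  have := finite_of_finite_field (K := K) (V := V)
  rw [← ncard_hat, ← ncard_submodule]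
  have : (U : Set V) = insert 0 (hat (pts U)) := by
    ext v
    simp only [SetLike.mem_coe, Set.mem_insert_iff, mem_hat_pts]
    by_cases h : v = 0 <;> simp [h]
  rw [this, Set.ncard_insert_of_notMem (fun h => h.1 rfl)]

theorem finite_projectivization [Finite K] [Module.Finite K V] : Finite (ℙ K V) := by
  have := finite_of_finite_field (K := K) (V := V)
  infer_instance

/-- Counting the points of `T` in the pencil of hyperplanes of `W` spanned by `f` and `g`. -/
theorem ncard_pencil [Module.Finite K V] [Fintype K] (T : Set (ℙ K V)) (W : Submodule K V)
    (f g : V →ₗ[K] K) :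
    ∑ t : K, (T ∩ pts (W ⊓ LinearMap.ker (g - t • f))).ncard
        + (T ∩ pts (W ⊓ LinearMap.ker f)).ncard
      = (T ∩ pts W).ncard
        + Nat.card K * (T ∩ pts (W ⊓ LinearMap.ker f ⊓ LinearMap.ker g)).ncard := by
  classical
  have := finite_projectivization (K := K) (V := V)
  have := Fintype.ofFinite (ℙ K V)
  have conv : ∀ U : Submodule K V, (T ∩ pts U).ncard
      = ∑ X : ℙ K V, if X ∈ T ∧ X.rep ∈ U then 1 else 0 := by
    intro U
    rw [Set.ncard_eq_toFinset_card', Finset.card_eq_sum_ones, ← Finset.sum_filter]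
    refine Finset.sum_congr ?_ fun _ _ => rfl
    ext X
    simp [mem_pts_iff]
  simp only [conv]
  rw [Finset.sum_comm, ← Finset.sum_add_distrib, Finset.mul_sum, ← Finset.sum_add_distrib]
  refine Finset.sum_congr rfl fun X _ => ?_
  by_cases hX : X ∈ T ∧ X.rep ∈ W
  · obtain ⟨hT, hW⟩ := hX
    simp only [hT, hW, true_and, Submodule.mem_inf, LinearMap.mem_ker, LinearMap.sub_apply,
      LinearMap.smul_apply, smul_eq_mul, if_true]
    by_cases hf : f X.rep = 0
    · by_cases hg : g X.rep = 0 <;> simp [hf, hg, add_comm]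
    -- A point off `ker f` lies on exactly one member of the pencil, whereas common zeros of `f` and
    -- `g` lie on all `q + 1`. Independence of `f` and `g` plays no role.
    · have : ∀ t : K, g X.rep - t * f X.rep = 0 ↔ t = g X.rep / f X.rep := by
        intro t
        rw [eq_div_iff hf, sub_eq_zero, eq_comm]
      simp [hf, this]
  · rcases not_and_or.1 hX with h | h <;> simp [h]

end Counting

/-! ### Functionals with prescribed values and hyperplanes as kernels. -/

section LinearAlgebra

variable {K V : Type*} [Field K] [AddCommGroup V] [Module K V]

theorem exists_functional_eq {ι : Type*} {v : ι → V} (hv : LinearIndependent K v) (c : ι → K) :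
    ∃ f : V →ₗ[K] K, ∀ i, f (v i) = c i := by
  refine ⟨(Basis.sumExtend hv).constr K (Sum.elim c 0), fun i => ?_⟩
  have h : v i = Basis.sumExtend hv (Sum.inl i) := by
    simp [Basis.sumExtend]
    rfl
  rw [h, Basis.constr_basis]
  rfl

theorem finrank_inf_ker [Module.Finite K V] {U : Submodule K V} {f : V →ₗ[K] K} {u : V}
    (hu : u ∈ U) (hf : f u ≠ 0) : finrank K ↥(U ⊓ LinearMap.ker f) + 1 = finrank K U := by
  have h1 := LinearMap.finrank_range_add_finrank_ker (f.comp U.subtype)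
  have h2 : LinearMap.range (f.comp U.subtype) = ⊤ := by
    refine LinearMap.range_eq_top.2 (LinearMap.surjective ?_)
    intro h
    exact hf (by simpa using LinearMap.congr_fun h ⟨u, hu⟩)
  have h3 : (U ⊓ LinearMap.ker f) = (LinearMap.ker (f.comp U.subtype)).map U.subtype := by
    ext x
    simp [LinearMap.mem_ker, and_comm]
  rw [h3, Submodule.finrank_map_subtype_eq, ← h1, h2, finrank_top, Module.finrank_self, add_comm]

theorem eq_of_le_of_finrank_eq [Module.Finite K V] {A B : Submodule K V} (h : A ≤ B)
    (hAB : finrank K A = finrank K B) : A = B :=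
  Submodule.eq_of_le_of_finrank_eq h hAB

theorem exists_eq_inf_ker [Module.Finite K V] {A B : Submodule K V} (h : A ≤ B)
    (hAB : finrank K A + 1 = finrank K B) {u : V} (hu : u ∈ B) (huA : u ∉ A) :
    ∃ f : V →ₗ[K] K, f u = 1 ∧ A = B ⊓ LinearMap.ker f := by
  obtain ⟨f, hfu, hfA⟩ := Submodule.exists_dual_map_eq_bot_of_notMem huA inferInstance
  have hA : ∀ a ∈ A, f a = 0 := fun a ha => by
    have : f a ∈ A.map f := ⟨a, ha, rfl⟩
    rwa [hfA] at this
  refine ⟨(f u)⁻¹ • f, by simp [hfu], ?_⟩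
  refine eq_of_le_of_finrank_eq (fun a ha => ⟨h ha, by simp [hA a ha]⟩) ?_
  have := finrank_inf_ker (f := (f u)⁻¹ • f) hu (by simp [hfu])
  lia

theorem exists_mem_notMem_of_finrank_lt [Module.Finite K V] {A B : Submodule K V}
    (h : finrank K A < finrank K B) : ∃ u ∈ B, u ∉ A := by
  by_contra! hc
  exact absurd (Submodule.finrank_mono (show B ≤ A from hc)) (by lia)

end LinearAlgebra

/-! ### Quadratic forms over a finite field of characteristic two. -/

section Quadrics

variable {K V : Type*} [Field K] [AddCommGroup V] [Module K V]

theorem charP_two_of_even_card [Finite K] (hq : Even (Nat.card K)) : CharP K 2 := by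
  have := Fintype.ofFinite K
  refine ringChar.of_eq (FiniteField.even_card_iff_char_two.2 ?_)
  rw [← Nat.card_eq_fintype_card]
  exact Nat.even_iff.1 hq

theorem exists_sq_eq [Finite K] [CharP K 2] (a : K) : ∃ t, t * t = a := by
  obtain ⟨t, ht⟩ := FiniteField.isSquare_of_char_two (F := K) (ringChar.eq K 2) a
  exact ⟨t, ht.symm⟩

theorem existsUnique_sq_eq [Finite K] [CharP K 2] (a : K) : ∃! t, t * t = a := by
  obtain ⟨t, ht⟩ := exists_sq_eq a
  refine ⟨t, ht, fun s hs => ?_⟩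
  have : (s - t) * (s - t) = 0 := by
    have h2 : (2 : K) = 0 := CharP.cast_eq_zero K 2
    linear_combination hs - ht + (t * t - s * t) * h2
  exact sub_eq_zero.1 (mul_self_eq_zero.1 this)

theorem map_add_smul (Q : QuadraticForm K V) (v u : V) (t : K) :
    Q (v + t • u) = Q v + t * t * Q u + t * QuadraticMap.polar Q u v := by
  rw [QuadraticMap.map_add Q v, QuadraticMap.map_smul, QuadraticMap.polar_comm,
    QuadraticMap.polar_smul_left]
  simp

theorem existsUnique_zero_of_polar_ne (Q : QuadraticForm K V) {v u : V} (hu : Q u = 0)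
    (h : QuadraticMap.polar Q u v ≠ 0) : ∃! t : K, Q (v + t • u) = 0 := by
  simp only [map_add_smul, hu, mul_zero, add_zero]
  refine ⟨-Q v / QuadraticMap.polar Q u v, by field_simp; ring, fun t ht => ?_⟩
  rw [eq_div_iff h]
  linear_combination ht

/-- With the linear term gone, the equation in `t` is `Q v + t ^ 2 * Q u = 0`, and squaring is a
bijection of a finite field of characteristic two. This is why every line through the nucleus
carries one point of the quadric. -/
theorem existsUnique_zero_of_polar_eq [Finite K] [CharP K 2] (Q : QuadraticForm K V) {v u : V}
    (hu : Q u ≠ 0) (h : QuadraticMap.polar Q u v = 0) : ∃! t : K, Q (v + t • u) = 0 := by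
  simp only [map_add_smul, h, mul_zero, add_zero]
  obtain ⟨t, ht, hu'⟩ := existsUnique_sq_eq (-Q v / Q u)
  refine ⟨t, ?_, fun s hs => hu' s ?_⟩
  · simp only [ht]
    field_simp
    ring
  · simp only
    rw [eq_div_iff hu]
    linear_combination hs

theorem polar_self_of_char_two [CharP K 2] (Q : QuadraticForm K V) (v : V) :
    QuadraticMap.polar Q v v = 0 := by
  rw [QuadraticMap.polar_self, two_nsmul, CharTwo.add_self_eq_zero]

/-- The number of vectors on a nontrivial affine hyperplane. -/
theorem card_mul_ncard_fiber [Finite V] (f : V →ₗ[K] K) {u : V} (hu : f u ≠ 0) (c : K) :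
    Nat.card K * {v | f v = c}.ncard = Nat.card V := by
  have := card_mul_ncard_of_translate (D := Set.univ) (Z := {v | f v = c}) (u := u)
    (fun _ _ _ => trivial) (fun v _ => ⟨(c - f v) / f u, by simp [hu], fun t ht => by
      rw [eq_div_iff hu]
      simp only [Set.mem_ofPred_eq, map_add, map_smul, smul_eq_mul] at ht
      linear_combination ht⟩)
  simpa [Set.ncard_univ] using this

/-- The determinant of an alternating matrix of odd size vanishes in characteristic two. -/
theorem det_eq_zero_of_alternating {n : Type*} [Fintype n] [DecidableEq n] [CharP K 2]
    (hn : Odd (Fintype.card n)) (A : Matrix n n K) (hs : ∀ i j, A i j = A j i)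
    (hd : ∀ i, A i i = 0) : A.det = 0 := by
  rw [Matrix.det_apply']
  have h2 : ∀ z : ℤˣ, ((z : ℤ) : K) = 1 := by
    intro z
    rcases Int.units_eq_one_or z with rfl | rfl <;> simp [CharTwo.neg_eq]
  simp only [h2, one_mul]
  refine Finset.sum_involution (fun σ _ => σ⁻¹) (fun σ _ => ?_) (fun σ _ hσ h => ?_)
    (fun _ _ => Finset.mem_univ _) (fun σ _ => inv_inv σ)
  · have : ∏ i, A (σ⁻¹ i) i = ∏ i, A (σ i) i := by
      rw [← Equiv.prod_comp σ]
      exact Finset.prod_congr rfl fun i _ => by simp [hs]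
    rw [this, CharTwo.add_self_eq_zero]
  -- A permutation left unpaired is its own inverse. A nonzero term also forbids fixed points,
  -- because the diagonal is zero, and an involution without fixed points needs an even number of
  -- indices.
  · have hsq : σ ^ 2 = 1 := by
      rw [sq]
      nth_rewrite 1 [← h]
      simp
    have hfix : ∀ i, σ i ≠ i := fun i hi =>
      hσ (Finset.prod_eq_zero (Finset.mem_univ i) (by rw [hi, hd]))
    have hsupp : σ.support = Finset.univ := by
      ext i
      simp [hfix i]
    have := Equiv.Perm.two_dvd_card_support hsq
    rw [hsupp, Finset.card_univ] at this
    exact (Nat.not_even_iff_odd.2 hn) (even_iff_two_dvd.2 this)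

/-- The Gram matrix of the polar form is alternating of odd size, hence singular; a kernel vector
gives the radical. -/
theorem exists_polar_radical [CharP K 2] [Module.Finite K V] (hV : Odd (finrank K V))
    (Q : QuadraticForm K V) : ∃ n : V, n ≠ 0 ∧ ∀ v, QuadraticMap.polar Q n v = 0 := by
  classical
  let b := Module.finBasis K V
  let A : Matrix (Fin (finrank K V)) (Fin (finrank K V)) K :=
    fun i j => QuadraticMap.polar Q (b i) (b j)
  have hA : A.det = 0 := det_eq_zero_of_alternating (by simpa using hV) A
    (fun i j => QuadraticMap.polar_comm _ _ _) (fun i => polar_self_of_char_two Q _)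
  obtain ⟨c, hc, hAc⟩ := Matrix.exists_vecMul_eq_zero_iff.2 hA
  refine ⟨∑ i, c i • b i, ?_, ?_⟩
  · intro h
    apply hc
    ext i
    exact Fintype.linearIndependent_iff.1 b.linearIndependent c h i
  · have h0 : Q.polarBilin (∑ i, c i • b i) = 0 := by
      refine b.ext fun j => ?_
      have := congr_fun hAc j
      simpa [Matrix.vecMul, dotProduct, A] using this
    intro v
    exact LinearMap.congr_fun h0 v

/-- Scaling by a square root of `a` carries the fibre over `1` onto the fibre over `a`. -/
theorem ncard_fiber_eq [Finite K] [CharP K 2] (Q : QuadraticForm K V) {a : K} (ha : a ≠ 0) :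
    {v | Q v = a}.ncard = {v | Q v = 1}.ncard := by
  obtain ⟨t, rfl⟩ := exists_sq_eq a
  have ht : t ≠ 0 := by
    rintro rfl
    simp at ha
  rw [← Set.ncard_image_of_injective {v | Q v = 1} (smul_right_injective V ht)]
  congr 1
  ext v
  constructor
  · intro hv
    refine ⟨t⁻¹ • v, ?_, by simp [smul_smul, ht]⟩
    simp only [Set.mem_ofPred_eq] at hv ⊢
    rw [QuadraticMap.map_smul, hv]
    simp only [smul_eq_mul]
    field_simp
  · rintro ⟨w, hw, rfl⟩
    simp only [Set.mem_ofPred_eq] at hw ⊢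
    rw [QuadraticMap.map_smul, hw]
    simp

/-- A quadratic form in four variables with nondegenerate polar form has
`q ^ 3 + (q - 1) q` or `q ^ 3 - (q - 1) q` zeros. -/
theorem ncard_zeros_of_nondegenerate [Finite K] [CharP K 2] [Module.Finite K V]
    (hV : finrank K V = 4) (Q : QuadraticForm K V)
    (hQ : ∀ u : V, u ≠ 0 → ∃ v, QuadraticMap.polar Q u v ≠ 0) :
    (({v | Q v = 0}.ncard : ℤ) - Nat.card K ^ 3) ^ 2 = ((Nat.card K - 1) * Nat.card K) ^ 2 := by
  classical
  have := finite_of_finite_field (K := K) (V := V)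
  have := Fintype.ofFinite V
  have := Fintype.ofFinite K
  set q := Nat.card K with hq
  have hcard : Nat.card V = q ^ 4 := by rw [Module.natCard_eq_pow_finrank (K := K), hV]
  set N : K → ℕ := fun a => {v | Q v = a}.ncard with hN
  have hNs : ∀ a, N a = ∑ v : V, if Q v = a then 1 else 0 := by
    intro a
    simp only [hN]
    rw [Set.ncard_eq_toFinset_card', Finset.card_eq_sum_ones, ← Finset.sum_filter]
    exact Finset.sum_congr (by ext; simp) fun _ _ => rfl
  have split : ∀ g : ℕ → ℕ, ∑ a, g (N a) = g (N 0) + (q - 1) * g (N 1) := by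
    intro g
    rw [← Finset.add_sum_erase _ _ (Finset.mem_univ (0 : K))]
    congr 1
    rw [Finset.sum_congr rfl (fun a ha => by
      rw [show N a = N 1 from ncard_fiber_eq Q (Finset.ne_of_mem_erase ha)])]
    rw [Finset.sum_const, Finset.card_erase_of_mem (Finset.mem_univ _), Finset.card_univ, hq,
      Nat.card_eq_fintype_card, smul_eq_mul]
  have first : N 0 + (q - 1) * N 1 = q ^ 4 := by
    rw [← split fun x => x]
    simp only [hNs]
    rw [Finset.sum_comm]
    simp [← hcard]
  have fib : ∀ u : V, u ≠ 0 →
      (∑ v : V, if QuadraticMap.polar Q u v = Q u then 1 else 0) = q ^ 3 := by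
    intro u hu
    obtain ⟨w, hw⟩ := hQ u hu
    have h := card_mul_ncard_fiber (Q.polarBilin u) (u := w) (by simpa using hw) (Q u)
    rw [hcard, pow_succ', ← hq] at h
    have := Nat.eq_of_mul_eq_mul_left Nat.card_pos h
    rw [← this, Set.ncard_eq_toFinset_card', Finset.card_eq_sum_ones, ← Finset.sum_filter]
    exact Finset.sum_congr (by ext; simp) fun _ _ => rfl
  -- Second moment: count pairs of vectors with equal value by their difference `u`. For `u = 0` all
  -- `q ^ 4` vectors qualify, and for `u ≠ 0` an affine hyperplane of `q ^ 3` vectors does.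
  have second : N 0 ^ 2 + (q - 1) * N 1 ^ 2 = q ^ 4 + (q ^ 4 - 1) * q ^ 3 := by
    rw [← split fun x => x ^ 2]
    have h1 : ∑ a, N a ^ 2 = ∑ v : V, ∑ w : V, if Q w = Q v then 1 else 0 := by
      simp only [sq, hNs, Finset.sum_mul_sum]
      rw [Finset.sum_comm]
      refine Finset.sum_congr rfl fun v _ => ?_
      rw [Finset.sum_comm]
      refine Finset.sum_congr rfl fun w _ => ?_
      simp only [ite_mul, one_mul, zero_mul, Finset.sum_ite_eq, Finset.mem_univ, if_true]
    have h2 : ∀ v : V, (∑ w : V, if Q w = Q v then 1 else 0)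
        = ∑ u : V, if QuadraticMap.polar Q u v = Q u then 1 else 0 := by
      intro v
      rw [← Equiv.sum_comp (Equiv.addRight v)]
      refine Finset.sum_congr rfl fun u _ => ?_
      congr 1
      simp only [Equiv.coe_addRight, QuadraticMap.map_add Q u v, eq_iff_iff]
      rw [add_right_comm, add_eq_right, add_eq_zero_iff_eq_neg', CharTwo.neg_eq]
    rw [h1]
    simp only [h2]
    rw [Finset.sum_comm, ← Finset.add_sum_erase _ _ (Finset.mem_univ (0 : V))]
    congr 1
    · simp [QuadraticMap.polar_zero_left, ← hcard]
    · rw [Finset.sum_congr rfl (fun u hu => fib u (Finset.ne_of_mem_erase hu)), Finset.sum_const,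
        Finset.card_erase_of_mem (Finset.mem_univ _), Finset.card_univ, ← Nat.card_eq_fintype_card,
        hcard, smul_eq_mul]
  have hq1 : 1 ≤ q := one_lt_card_field.le
  have hq4 : 1 ≤ q ^ 4 := Nat.one_le_pow _ _ hq1
  zify [hq1, hq4] at first second
  have hq2 : (1 : ℤ) < q := by exact_mod_cast one_lt_card_field (K := K)
  change ((N 0 : ℤ) - q ^ 3) ^ 2 = ((q - 1) * q) ^ 2
  have e1 : (N 0 : ℤ) - q ^ 3 = (q - 1) * (q ^ 3 - N 1) := by linear_combination first
  have e2 : (N 0 : ℤ) = q ^ 3 + (q - 1) * (q ^ 3 - N 1) := by linear_combination first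
  -- Eliminating `N 0` from the two moments leaves `N 1 = q ^ 3 ± q`.
  have e3 : (q : ℤ) * (q - 1) * ((q ^ 3 - N 1) ^ 2 - q ^ 2) = 0 := by
    rw [e2] at second
    linear_combination second
  have e4 : ((q : ℤ) ^ 3 - N 1) ^ 2 - q ^ 2 = 0 := by
    refine (mul_eq_zero.1 e3).resolve_left (mul_ne_zero ?_ ?_) <;> lia
  rw [e1]
  linear_combination ((q : ℤ) - 1) ^ 2 * e4

end Quadrics

/-! ### Hyperplane sections of the quadric and reduction to plane sections of `H`. -/

section Hyperplanes

variable {K V : Type*} [Field K] [AddCommGroup V] [Module K V]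

theorem existsUnique_add_smul_mem [Module.Finite K V] {A B : Submodule K V} (h : A ≤ B)
    (hAB : finrank K A + 1 = finrank K B) {u : V} (hu : u ∈ B) (huA : u ∉ A) {v : V} (hv : v ∈ B) :
    ∃! t : K, v + t • u ∈ A := by
  obtain ⟨f, hf, rfl⟩ := exists_eq_inf_ker h hAB hu huA
  refine ⟨-f v, ⟨B.add_mem hv (B.smul_mem _ hu), by simp [hf]⟩, fun t ht => ?_⟩
  have : f (v + t • u) = 0 := ht.2
  simp only [map_add, map_smul, hf, smul_eq_mul, mul_one] at this
  linear_combination this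

theorem ncard_quadric_inter [Finite K] [Module.Finite K V] (Q : QuadraticForm K V)
    (U : Submodule K V) :
    (Nat.card K - 1) * (quadric Q ∩ pts U).ncard + 1 = {v | v ∈ U ∧ Q v = 0}.ncard := by
  have := finite_of_finite_field (K := K) (V := V)
  rw [← ncard_hat]
  have : {v | v ∈ U ∧ Q v = 0} = insert 0 (hat (quadric Q ∩ pts U)) := by
    ext v
    simp only [Set.mem_ofPred_eq, Set.mem_insert_iff, mem_hat_inter_pts, mem_hat_quadric]
    by_cases h : v = 0
    · simp [h]
    · simp [h, and_comm]
  rw [this, Set.ncard_insert_of_notMem (fun h => h.1 rfl)]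

/-- Each coset of the line spanned by `n` contains exactly one zero. -/
theorem ncard_zeros_of_radical [Finite K] [CharP K 2] [Module.Finite K V] (Q : QuadraticForm K V)
    {U : Submodule K V} {n : V} (hnU : n ∈ U) (hn : Q n ≠ 0)
    (hp : ∀ v ∈ U, QuadraticMap.polar Q n v = 0) :
    Nat.card K * {v | v ∈ U ∧ Q v = 0}.ncard = Nat.card K ^ finrank K U := by
  have := finite_of_finite_field (K := K) (V := V)
  rw [← ncard_submodule U]
  exact card_mul_ncard_of_translate (D := (U : Set V)) (Z := {v | Q v = 0}) (u := n)
    (fun v hv t => U.add_mem hv (U.smul_mem t hnU))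
    (fun v hv => existsUnique_zero_of_polar_eq Q hn (hp v hv))

theorem eq_of_sub_one_mul_eq [Finite K] {c d : ℕ}
    (h : ((Nat.card K : ℤ) - 1) * c = (Nat.card K - 1) * d) : c = d := by
  have : (1 : ℤ) < Nat.card K := by exact_mod_cast one_lt_card_field (K := K)
  have := mul_left_cancel₀ (by lia : (Nat.card K : ℤ) - 1 ≠ 0) h
  exact_mod_cast this

theorem cast_card_sub_one [Finite K] : ((Nat.card K - 1 : ℕ) : ℤ) = (Nat.card K : ℤ) - 1 := by
  have := one_lt_card_field (K := K)
  lia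

theorem ncard_quadric_inter_of_radical [Finite K] [CharP K 2] [Module.Finite K V]
    (Q : QuadraticForm K V) {U : Submodule K V} {n : V} (hnU : n ∈ U) (hn : Q n ≠ 0)
    (hp : ∀ v ∈ U, QuadraticMap.polar Q n v = 0) (hU : finrank K U = 4) :
    (quadric Q ∩ pts U).ncard = Nat.card K ^ 2 + Nat.card K + 1 := by
  have h1 := ncard_zeros_of_radical Q hnU hn hp
  rw [hU, pow_succ'] at h1
  have h2 := ncard_quadric_inter Q U
  rw [Nat.eq_of_mul_eq_mul_left Nat.card_pos h1] at h2
  refine eq_of_sub_one_mul_eq (K := K) ?_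
  zify [cast_card_sub_one] at h2
  push_cast
  linear_combination h2

/-- Off the nucleus the restricted polar form is nondegenerate, so the count of zeros in four
variables applies. A vector `u` of its radical could be moved along `n` to a zero of `Q` orthogonal
to all of `V`, a singular point. -/
theorem ncard_quadric_inter_of_notMem [Finite K] [CharP K 2] [Module.Finite K V]
    (hV : finrank K V = 5) {Q : QuadraticForm K V} (hQ : Nonsingular Q) {U : Submodule K V} {n : V}
    (hnU : n ∉ U) (hn : Q n ≠ 0) (hp : ∀ v, QuadraticMap.polar Q n v = 0)
    (hU : finrank K U = 4) :
    (quadric Q ∩ pts U).ncard = Nat.card K ^ 2 + 1 ∨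
      (quadric Q ∩ pts U).ncard = Nat.card K ^ 2 + 2 * Nat.card K + 1 := by
  have key := ncard_zeros_of_nondegenerate hU (Q.comp U.subtype) (by
    intro u hu
    by_contra! h
    obtain ⟨t, ht, -⟩ := existsUnique_zero_of_polar_eq Q (v := (u : V)) hn (hp u)
    have hne : (u : V) + t • n ≠ 0 := by
      intro h0
      by_cases htz : t = 0
      · exact hu (by simpa [htz] using h0)
      · refine hnU ?_
        have : n = (-t⁻¹) • (u : V) := by
          rw [eq_neg_of_add_eq_zero_left h0]
          simp [smul_smul, htz]
        rw [this]
        exact U.smul_mem _ u.2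
    obtain ⟨w, hw⟩ := hQ _ hne ht
    obtain ⟨s, hs, -⟩ := existsUnique_add_smul_mem (A := U) (B := ⊤) le_top
      (by rw [hU, finrank_top, hV]) (u := n) trivial hnU (v := w) trivial
    apply hw
    have h3 : QuadraticMap.polar Q u (w + s • n) = 0 := h ⟨_, hs⟩
    rw [QuadraticMap.polar_add_right, QuadraticMap.polar_smul_right, QuadraticMap.polar_comm Q u n,
      hp] at h3
    rw [QuadraticMap.polar_add_left, QuadraticMap.polar_smul_left, hp]
    simpa using h3)
  have h2 := ncard_quadric_inter Q U
  have h3 : {v : U | (Q.comp U.subtype) v = 0}.ncard = {v | v ∈ U ∧ Q v = 0}.ncard := by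
    rw [← Set.ncard_image_of_injective _ U.injective_subtype]
    congr 1
    ext v
    simp [and_comm]
  rw [h3] at key
  zify [cast_card_sub_one] at h2
  rcases sq_eq_sq_iff_eq_or_eq_neg.1 key with h | h
  · right
    refine eq_of_sub_one_mul_eq (K := K) ?_
    push_cast
    linear_combination h2 + h
  · left
    refine eq_of_sub_one_mul_eq (K := K) ?_
    push_cast
    linear_combination h2 + h

/-- The possible sizes of a hyperplane section of a non-singular quadric in `PG(4, q)`. -/
def IsHyperplaneSize (q k : ℕ) : Prop := k = q ^ 2 + 1 ∨ k = q ^ 2 + q + 1 ∨ k = q ^ 2 + 2 * q + 1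

theorem isHyperplaneSize_of_nonsingular [Finite K] [CharP K 2] [Module.Finite K V]
    (hV : finrank K V = 5) {Q : QuadraticForm K V} (hQ : Nonsingular Q) {U : Submodule K V}
    (hU : IsHyperplane U) : IsHyperplaneSize (Nat.card K) (quadric Q ∩ pts U).ncard := by
  have hU4 : finrank K U = 4 := by
    unfold IsHyperplane at hU
    lia
  obtain ⟨n, hn0, hn⟩ := exists_polar_radical (by rw [hV]; decide) Q
  have hQn : Q n ≠ 0 := fun h => by
    obtain ⟨w, hw⟩ := hQ n hn0 h
    exact hw (hn w)
  by_cases hnU : n ∈ U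
  · exact Or.inr (Or.inl (ncard_quadric_inter_of_radical Q hnU hQn (fun v _ => hn v) hU4))
  · rcases ncard_quadric_inter_of_notMem hV hQ hnU hQn hn hU4 with h | h
    · exact Or.inl h
    · exact Or.inr (Or.inr h)

/-- `p` spans a singular point of `Q`, `H` is the hyperplane orthogonal to `p`, and `n` spans the
nucleus of `Q`. -/
structure IsTangentSolid (Q : QuadraticForm K V) (H : Submodule K V) (p n : V) : Prop where
  finrank_eq : finrank K V = 5
  nonsingular : Nonsingular Q
  finrank_solid : finrank K H = 4
  ne_zero : p ≠ 0
  map_vertex : Q p = 0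
  mem_solid : ∀ v, v ∈ H ↔ QuadraticMap.polar Q p v = 0
  map_nucleus : Q n ≠ 0
  polar_nucleus : ∀ v, QuadraticMap.polar Q n v = 0

namespace IsTangentSolid

variable {Q : QuadraticForm K V} {H : Submodule K V} {p n : V}

theorem nucleus_mem (h : IsTangentSolid Q H p n) : n ∈ H := by
  rw [h.mem_solid, QuadraticMap.polar_comm, h.polar_nucleus]

theorem vertex_mem [CharP K 2] (h : IsTangentSolid Q H p n) : p ∈ H := by
  rw [h.mem_solid, polar_self_of_char_two]

theorem eq_ker (h : IsTangentSolid Q H p n) : H = LinearMap.ker (Q.polarBilin p) := by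
  ext v
  simp [h.mem_solid]

theorem linearIndependent (h : IsTangentSolid Q H p n) : LinearIndependent K ![p, n] := by
  refine (LinearIndependent.pair_iff' h.ne_zero).2 fun a ha => ?_
  apply h.map_nucleus
  rw [← ha, QuadraticMap.map_smul, h.map_vertex, smul_zero]

theorem exists_hyperplane [Module.Finite K V] (h : IsTangentSolid Q H p n) {α : Submodule K V} (hα : α ≤ H)
    (hα3 : finrank K α = 3) : ∃ U : Submodule K V, IsHyperplane U ∧ U ⊓ H = α := by
  obtain ⟨u, huH, huα⟩ := exists_mem_notMem_of_finrank_lt (A := α) (B := H)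
    (by rw [hα3, h.finrank_solid]; norm_num)
  obtain ⟨g, hgu, hg⟩ := exists_eq_inf_ker hα (by rw [hα3, h.finrank_solid]) huH huα
  refine ⟨LinearMap.ker g, ?_, by rw [hg, inf_comm]⟩
  have := finrank_inf_ker (U := ⊤) (f := g) (u := u) trivial (by simp [hgu])
  rwa [top_inf_eq, finrank_top] at this

theorem finrank_inf [Module.Finite K V] (h : IsTangentSolid Q H p n) {U : Submodule K V} (hU : IsHyperplane U)
    (hUH : U ≠ H) : finrank K ↥(U ⊓ H) = 3 := by
  have hU4 : finrank K U = 4 := by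
    have := h.finrank_eq
    unfold IsHyperplane at hU
    lia
  have hnle : ¬ U ≤ H := fun hle =>
    hUH (eq_of_le_of_finrank_eq hle (by rw [hU4, h.finrank_solid]))
  obtain ⟨u, huU, huH⟩ := SetLike.not_le_iff_exists.1 hnle
  have := finrank_inf_ker (f := Q.polarBilin p) huU (by simpa [h.mem_solid] using huH)
  rw [h.eq_ker]
  lia

theorem exists_plane [CharP K 2] [Module.Finite K V] (h : IsTangentSolid Q H p n) :
    ∃ α ≤ H, finrank K α = 3 ∧ p ∉ α ∧ n ∉ α := by
  obtain ⟨f, hf⟩ := exists_functional_eq h.linearIndependent (fun _ => 1)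
  have hp : f p = 1 := hf 0
  have hn : f n = 1 := hf 1
  refine ⟨H ⊓ LinearMap.ker f, inf_le_left, ?_, ?_, ?_⟩
  · have := finrank_inf_ker (f := f) h.vertex_mem (by simp [hp])
    rw [h.finrank_solid] at this
    lia
  · simp [hp]
  · simp [hn]

variable [Finite K] [CharP K 2] [Module.Finite K V]

theorem ncard_solid (h : IsTangentSolid Q H p n) :
    (quadric Q ∩ pts H).ncard = Nat.card K ^ 2 + Nat.card K + 1 :=
  ncard_quadric_inter_of_radical Q h.nucleus_mem h.map_nucleus (fun v _ => h.polar_nucleus v)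
    h.finrank_solid

theorem ncard_top (h : IsTangentSolid Q H p n) :
    (quadric Q ∩ pts ⊤).ncard = Nat.card K ^ 3 + Nat.card K ^ 2 + Nat.card K + 1 := by
  have h1 := ncard_zeros_of_radical Q (U := ⊤) trivial h.map_nucleus
    (fun v _ => h.polar_nucleus v)
  rw [finrank_top, h.finrank_eq, pow_succ'] at h1
  have h2 := ncard_quadric_inter Q ⊤
  rw [Nat.eq_of_mul_eq_mul_left Nat.card_pos h1] at h2
  refine eq_of_sub_one_mul_eq (K := K) ?_
  zify [cast_card_sub_one] at h2
  push_cast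
  linear_combination h2

/-- The zeros in `H` number `q ^ 3` and are invariant under translation by `p`. Each coset meets `α`
once, leaving `q ^ 2` zero vectors in `α`. -/
theorem ncard_plane (h : IsTangentSolid Q H p n) {α : Submodule K V} (hα : α ≤ H)
    (hα3 : finrank K α = 3) (hp : p ∉ α) :
    (quadric Q ∩ pts α).ncard = Nat.card K + 1 := by
  have := finite_of_finite_field (K := K) (V := V)
  have h1 := ncard_zeros_of_radical Q h.nucleus_mem h.map_nucleus (fun v _ => h.polar_nucleus v)
  have h3 := card_mul_ncard_of_translate (D := {v | v ∈ H ∧ Q v = 0}) (Z := (α : Set V)) (u := p)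
    (fun v hv t => ⟨H.add_mem hv.1 (H.smul_mem t h.vertex_mem), by
      rw [map_add_smul, hv.2, h.map_vertex, (h.mem_solid v).1 hv.1]
      ring⟩)
    (fun v hv => existsUnique_add_smul_mem hα (by rw [hα3, h.finrank_solid]) h.vertex_mem hp hv.1)
  have h4 : {v | v ∈ H ∧ Q v = 0} ∩ (α : Set V) = {v | v ∈ α ∧ Q v = 0} := by
    ext v
    simp only [Set.mem_inter_iff, Set.mem_ofPred_eq, SetLike.mem_coe]
    exact ⟨fun h => ⟨h.2, h.1.2⟩, fun h => ⟨⟨hα h.1, h.2⟩, h.1⟩⟩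
  rw [h4] at h3
  rw [← h3, h.finrank_solid, pow_succ'] at h1
  have h5 := Nat.eq_of_mul_eq_mul_left Nat.card_pos h1
  rw [pow_succ'] at h5
  have h2 := ncard_quadric_inter Q α
  rw [Nat.eq_of_mul_eq_mul_left Nat.card_pos h5] at h2
  refine eq_of_sub_one_mul_eq (K := K) ?_
  zify [cast_card_sub_one] at h2
  push_cast
  linear_combination h2

/-- Partition `U \ H` into cosets in the direction `p` or `n`. Each contains one zero: for `p` the
equation is linear with nonzero slope off `H`, and for `n` it is purely quadratic. -/
theorem ncard_diff (h : IsTangentSolid Q H p n) {U : Submodule K V} (hU : IsHyperplane U)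
    (hUH : U ≠ H) (hpn : p ∈ U ∨ n ∈ U) :
    ((quadric Q ∩ pts U) \ pts H).ncard = Nat.card K ^ 2 := by
  have := finite_of_finite_field (K := K) (V := V)
  have hU4 : finrank K U = 4 := by
    have := h.finrank_eq
    unfold IsHyperplane at hU
    lia
  have hD : ((U : Set V) \ H).ncard + Nat.card K ^ 3 = Nat.card K ^ 4 := by
    rw [← h.finrank_inf hU hUH, ← ncard_submodule, ← hU4, ← ncard_submodule, add_comm]
    exact Set.ncard_inter_add_ncard_sdiff_eq_ncard _ _ (Set.toFinite _)
  have hZ : Nat.card K * (((U : Set V) \ H) ∩ {v | Q v = 0}).ncard = ((U : Set V) \ H).ncard := by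
    have close : ∀ u ∈ U, u ∈ H → ∀ v ∈ (U : Set V) \ H, ∀ t : K, v + t • u ∈ (U : Set V) \ H :=
      fun u hu hu' v hv t => ⟨U.add_mem hv.1 (U.smul_mem t hu), fun hc =>
        hv.2 ((Submodule.add_mem_iff_left H (H.smul_mem t hu')).1 hc)⟩
    rcases hpn with hp | hn
    · exact card_mul_ncard_of_translate (close p hp h.vertex_mem) fun v hv =>
        existsUnique_zero_of_polar_ne Q h.map_vertex fun hc => hv.2 ((h.mem_solid v).2 hc)
    · exact card_mul_ncard_of_translate (close n hn h.nucleus_mem) fun v hv =>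
        existsUnique_zero_of_polar_eq Q h.map_nucleus (h.polar_nucleus v)
  have hhat : hat ((quadric Q ∩ pts U) \ pts H) = ((U : Set V) \ H) ∩ {v | Q v = 0} := by
    ext v
    constructor
    · rintro ⟨hv, h1, h2⟩
      exact ⟨⟨(mk_mem_pts hv).1 h1.2, fun hc => h2 ((mk_mem_pts hv).2 hc)⟩,
        (mem_hat_quadric.1 ⟨hv, h1.1⟩).2⟩
    · rintro ⟨⟨h1, h2⟩, h3⟩
      have hv : v ≠ 0 := fun h0 => h2 (by simp [h0])
      exact ⟨hv, ⟨(mk_mem_iff hv).2 (mem_hat_quadric.2 ⟨hv, h3⟩), (mk_mem_pts hv).2 h1⟩,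
        fun hc => h2 ((mk_mem_pts hv).1 hc)⟩
  rw [← hhat, ncard_hat] at hZ
  refine eq_of_sub_one_mul_eq (K := K) ?_
  have hq : (Nat.card K : ℤ) ≠ 0 := by exact_mod_cast Nat.card_pos.ne'
  refine mul_left_cancel₀ hq ?_
  zify [cast_card_sub_one] at hZ hD
  push_cast
  linear_combination hZ + hD

/-- Both elliptic and hyperbolic hyperplanes pass through a plane of the tangent solid containing
neither the vertex nor the nucleus. -/
theorem exists_hyperplanes (h : IsTangentSolid Q H p n) {α : Submodule K V} (hα : α ≤ H)
    (hα3 : finrank K α = 3) (hp : p ∉ α) (hn : n ∉ α) :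
    (∃ U : Submodule K V, IsHyperplane U ∧ U ⊓ H = α ∧
        (quadric Q ∩ pts U).ncard = Nat.card K ^ 2 + 1) ∧
      ∃ U : Submodule K V, IsHyperplane U ∧ U ⊓ H = α ∧
        (quadric Q ∩ pts U).ncard = Nat.card K ^ 2 + 2 * Nat.card K + 1 := by
  have := Fintype.ofFinite K
  obtain ⟨g, hgp, hg⟩ := exists_eq_inf_ker hα (by rw [hα3, h.finrank_solid]) h.vertex_mem hp
  set f : V →ₗ[K] K := Q.polarBilin p with hf
  have hfp : f p = 0 := by simpa [hf] using polar_self_of_char_two Q p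
  have hfn : f n = 0 := by
    have := (h.mem_solid n).1 h.nucleus_mem
    simpa [hf] using this
  have hgn : g n ≠ 0 := fun hc => hn (by rw [hg]; exact ⟨h.nucleus_mem, hc⟩)
  have pencil := ncard_pencil (quadric Q) ⊤ f g
  have hU : ∀ t : K, IsHyperplane (LinearMap.ker (g - t • f)) := by
    intro t
    have := finrank_inf_ker (U := ⊤) (f := g - t • f) (u := p) trivial (by simp [hgp, hfp])
    rwa [top_inf_eq, finrank_top] at this
  have hinf : ∀ t : K, LinearMap.ker (g - t • f) ⊓ H = α := by
    intro t
    rw [hg, h.eq_ker, ← hf]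
    ext v
    simp only [Submodule.mem_inf, LinearMap.mem_ker, LinearMap.sub_apply, LinearMap.smul_apply,
      smul_eq_mul]
    constructor
    · rintro ⟨h1, h2⟩
      exact ⟨h2, by simpa [h2] using h1⟩
    · rintro ⟨h1, h2⟩
      exact ⟨by simp [h1, h2], h1⟩
  have hsize : ∀ t : K, (quadric Q ∩ pts (LinearMap.ker (g - t • f))).ncard = Nat.card K ^ 2 + 1 ∨
      (quadric Q ∩ pts (LinearMap.ker (g - t • f))).ncard
        = Nat.card K ^ 2 + 2 * Nat.card K + 1 := by
    intro t
    refine ncard_quadric_inter_of_notMem h.finrank_eq h.nonsingular (n := n) ?_ h.map_nucleus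
      h.polar_nucleus ?_
    · simpa [hfn] using hgn
    · have := hU t
      have := h.finrank_eq
      unfold IsHyperplane at *
      lia
  simp only [top_inf_eq] at pencil
  rw [← h.eq_ker, ← hg, h.ncard_plane hα hα3 hp, h.ncard_top, h.ncard_solid] at pencil
  have hq : 1 ≤ Nat.card K := Nat.card_pos
  -- The `q` hyperplanes other than `H` through `α` have average section size `q ^ 2 + q + 1`,
  -- strictly between the two possible values, so both values occur.
  have hconst : ∀ k : ℕ,
      (∀ t : K, (quadric Q ∩ pts (LinearMap.ker (g - t • f))).ncard = k) →
      Nat.card K * k + (Nat.card K ^ 2 + Nat.card K + 1)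
        = Nat.card K ^ 3 + Nat.card K ^ 2 + Nat.card K + 1 + Nat.card K * (Nat.card K + 1) := by
    intro k hk
    rw [← pencil]
    simp [hk]
  constructor
  · by_contra! hc
    have := hconst (Nat.card K ^ 2 + 2 * Nat.card K + 1)
      fun t => (hsize t).resolve_left (hc _ (hU t) (hinf t))
    nlinarith
  · by_contra! hc
    have := hconst (Nat.card K ^ 2 + 1)
      fun t => (hsize t).resolve_right (hc _ (hU t) (hinf t))
    nlinarith

/-- The sizes allowed by the definition are exactly the three numerical ones: no non-singular
quadric has others, and `Q` itself realises all three. -/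
theorem isParabolicQuasiQuadric_iff (h : IsTangentSolid Q H p n) (S : Set (ℙ K V)) :
    IsParabolicQuasiQuadric S ↔
      ∀ U : Submodule K V, IsHyperplane U → IsHyperplaneSize (Nat.card K) (S ∩ pts U).ncard := by
  constructor
  · rintro ⟨-, hS⟩ U hU
    obtain ⟨Q', U', hQ', hU', hc⟩ := hS U hU
    rw [hc]
    exact isHyperplaneSize_of_nonsingular h.finrank_eq hQ' hU'
  · intro hS
    refine ⟨by rw [h.finrank_eq]; decide, fun U hU => ?_⟩
    obtain ⟨α, hα, hα3, hp, hn⟩ := h.exists_plane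
    obtain ⟨⟨U₁, hU₁, -, h₁⟩, U₂, hU₂, -, h₂⟩ := h.exists_hyperplanes hα hα3 hp hn
    rcases hS U hU with hc | hc | hc
    · exact ⟨Q, U₁, h.nonsingular, hU₁, by rw [hc, h₁]⟩
    · exact ⟨Q, H, h.nonsingular, by rw [IsHyperplane, h.finrank_eq, h.finrank_solid],
        by rw [hc, h.ncard_solid]⟩
    · exact ⟨Q, U₂, h.nonsingular, hU₂, by rw [hc, h₂]⟩

end IsTangentSolid

/-- The plane intersection sizes, within the solid `H`, of the sets that may replace the tangent
cone of a quadric. -/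
structure HasPlaneSizes (H : Submodule K V) (p n : V) (T : Set (ℙ K V)) : Prop where
  subset : T ⊆ pts H
  ncard_eq : T.ncard = Nat.card K ^ 2 + Nat.card K + 1
  plane : ∀ α ≤ H, finrank K α = 3 → (T ∩ pts α).ncard = 1 ∨ (T ∩ pts α).ncard = Nat.card K + 1 ∨
    (T ∩ pts α).ncard = 2 * Nat.card K + 1
  plane_of_notMem : ∀ α ≤ H, finrank K α = 3 → p ∉ α → n ∉ α → (T ∩ pts α).ncard = Nat.card K + 1

/-- Since `S` and the quadric agree off `H`, the size of `S ∩ pts U` is that of the section of `S ∩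
pts H` by the plane `U ⊓ H` plus a number known from the quadric. -/
theorem IsTangentSolid.isParabolicQuasiQuadric_and_ncard_iff [Finite K] [CharP K 2]
    [Module.Finite K V] {Q : QuadraticForm K V} {H : Submodule K V} {p n : V}
    (h : IsTangentSolid Q H p n) {S : Set (ℙ K V)} (hS : S \ pts H = quadric Q \ pts H) :
    (IsParabolicQuasiQuadric S ∧ S.ncard = (quadric Q).ncard) ↔
      HasPlaneSizes H p n (S ∩ pts H) := by
  have := finite_projectivization (K := K) (V := V)
  rw [h.isParabolicQuasiQuadric_iff]
  have split : ∀ A B : Set (ℙ K V), A.ncard = (A ∩ B).ncard + (A \ B).ncard := fun A B =>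
    (Set.ncard_inter_add_ncard_sdiff_eq_ncard A B (Set.toFinite A)).symm
  have hcard : S.ncard = (quadric Q).ncard ↔
      (S ∩ pts H).ncard = Nat.card K ^ 2 + Nat.card K + 1 := by
    rw [split S (pts H), split (quadric Q) (pts H), hS, h.ncard_solid]
    lia
  have hdiff : ∀ U : Submodule K V, (S ∩ pts U) \ pts H = (quadric Q ∩ pts U) \ pts H := by
    intro U
    ext X
    have hX : (X ∈ S ∧ X ∉ pts H) ↔ (X ∈ quadric Q ∧ X ∉ pts H) := Set.ext_iff.1 hS X
    change ((X ∈ S ∧ X ∈ pts U) ∧ X ∉ pts H) ↔ ((X ∈ quadric Q ∧ X ∈ pts U) ∧ X ∉ pts H)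
    tauto
  have hpts : ∀ (A : Set (ℙ K V)) (U : Submodule K V), A ∩ pts U ∩ pts H = A ∩ pts (U ⊓ H) := by
    intro A U
    ext X
    simp [mem_pts_iff, and_assoc]
  have hS' : ∀ U α : Submodule K V, U ⊓ H = α →
      (S ∩ pts U).ncard = (S ∩ pts H ∩ pts α).ncard + ((quadric Q ∩ pts U) \ pts H).ncard := by
    rintro U _ rfl
    rw [split (S ∩ pts U) (pts H), hdiff, hpts]
    congr 2
    ext X
    simp only [Set.mem_inter_iff, mem_pts_iff, Submodule.mem_inf]
    tauto
  have hQ' : ∀ U α : Submodule K V, U ⊓ H = α → (quadric Q ∩ pts U).ncard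
      = (quadric Q ∩ pts α).ncard + ((quadric Q ∩ pts U) \ pts H).ncard := by
    rintro U _ rfl
    rw [split (quadric Q ∩ pts U) (pts H), hpts]
  have hne : ∀ U α : Submodule K V, finrank K α = 3 → U ⊓ H = α → U ≠ H := by
    rintro U _ hα rfl rfl
    rw [inf_idem, h.finrank_solid] at hα
    lia
  have hq : 2 ≤ Nat.card K := one_lt_card_field
  constructor
  · rintro ⟨hyp, hc⟩
    have key : ∀ α ≤ H, finrank K α = 3 → p ∉ α → n ∉ α →
        (S ∩ pts H ∩ pts α).ncard = Nat.card K + 1 := by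
      intro α hα hα3 hp hn
      obtain ⟨⟨U₁, hU₁, hi₁, h₁⟩, U₂, hU₂, hi₂, h₂⟩ := h.exists_hyperplanes hα hα3 hp hn
      have a₁ := hS' U₁ α hi₁
      have a₂ := hS' U₂ α hi₂
      have b₁ := hQ' U₁ α hi₁
      have b₂ := hQ' U₂ α hi₂
      rw [h.ncard_plane hα hα3 hp] at b₁ b₂
      -- Off `H`, `U₁` and `U₂` have `q ^ 2 - q` and `q ^ 2 + q` points. The first allows only `q +
      -- 1`, `2q + 1`, `3q + 1` points in `α`, the second only `1` and `q + 1`.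
      have c₁ := hyp U₁ hU₁
      have c₂ := hyp U₂ hU₂
      unfold IsHyperplaneSize at c₁ c₂
      generalize Nat.card K ^ 2 = r at *
      lia
    refine ⟨Set.inter_subset_right, hcard.1 hc, fun α hα hα3 => ?_, key⟩
    by_cases hpn : p ∉ α ∧ n ∉ α
    · exact Or.inr (Or.inl (key α hα hα3 hpn.1 hpn.2))
    · obtain ⟨U, hU, hi⟩ := h.exists_hyperplane hα hα3
      have hpn' : p ∈ U ∨ n ∈ U := by
        rw [not_and_or, not_not, not_not, ← hi] at hpn
        exact hpn.imp (fun hp => hp.1) (fun hn => hn.1)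
      have a := hS' U α hi
      rw [h.ncard_diff hU (hne U α hα3 hi) hpn'] at a
      have c := hyp U hU
      unfold IsHyperplaneSize at c
      generalize Nat.card K ^ 2 = r at *
      lia
  · intro hT
    refine ⟨fun U hU => ?_, hcard.2 hT.ncard_eq⟩
    by_cases hUH : U = H
    · subst hUH
      exact Or.inr (Or.inl hT.ncard_eq)
    have hα3 := h.finrank_inf hU hUH
    by_cases hpn : p ∈ U ∨ n ∈ U
    · have c := hT.plane _ inf_le_right hα3
      have a := hS' U _ rfl
      rw [h.ncard_diff hU hUH hpn] at a
      unfold IsHyperplaneSize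
      generalize Nat.card K ^ 2 = r at *
      lia
    · rw [not_or] at hpn
      have hp : p ∉ U ⊓ H := fun hc => hpn.1 hc.1
      have hn : n ∉ U ⊓ H := fun hc => hpn.2 hc.1
      rw [hS' U _ rfl, hT.plane_of_notMem _ inf_le_right hα3 hp hn,
        ← h.ncard_plane inf_le_right hα3 hp, ← hQ' U _ rfl]
      exact isHyperplaneSize_of_nonsingular h.finrank_eq h.nonsingular hU

end Hyperplanes

/-! ### From the geometric nucleus and singular solid to the polar form. -/

section TangentSolid

variable {K V : Type*} [Field K] [AddCommGroup V] [Module K V]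

theorem mem_hat_cone {P : ℙ K V} {B : Set (ℙ K V)} {v : V} :
    v ∈ hat (cone P B) ↔ v ≠ 0 ∧ ∃ b ∈ hat B, ∃ s t : K, v = s • P.rep + t • b := by
  constructor
  · rintro ⟨hv, b, hb, h⟩
    rw [mk_mem_pts, Projectivization.submodule_eq, Projectivization.submodule_eq,
      Submodule.mem_sup] at h
    obtain ⟨y, hy, z, hz, rfl⟩ := h
    obtain ⟨s, rfl⟩ := Submodule.mem_span_singleton.1 hy
    obtain ⟨t, rfl⟩ := Submodule.mem_span_singleton.1 hz
    exact ⟨hv, b.rep, rep_mem_hat.2 hb, s, t, rfl⟩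
  · rintro ⟨hv, b, ⟨hb, hb'⟩, s, t, h⟩
    refine ⟨hv, _, hb', ?_⟩
    rw [mk_mem_pts, Projectivization.submodule_eq, Projectivization.submodule_mk, h]
    exact Submodule.add_mem_sup (Submodule.smul_mem _ _ (Submodule.mem_span_singleton_self _))
      (Submodule.smul_mem _ _ (Submodule.mem_span_singleton_self _))

theorem finrank_span_pair {x y : V} (h : LinearIndependent K ![x, y]) :
    finrank K (Submodule.span K {x, y}) = 2 := by
  have := finrank_span_eq_card h
  rwa [Matrix.range_cons_cons_empty, Fintype.card_fin] at this

theorem IsNucleus.map_ne_zero {Q : QuadraticForm K V} {N : ℙ K V}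
    (hN : IsNucleus (quadric Q) N) : Q N.rep ≠ 0 := hN.1

/-- If `n` and `w` were not orthogonal, the line they span would carry a second point of the
quadric: restricted to a line through `N` and a point `X` of the quadric, the equation has the root
`X` and another, nonzero, root. -/
theorem IsNucleus.polar_eq_zero [CharP K 2] {Q : QuadraticForm K V} {N : ℙ K V}
    (hN : IsNucleus (quadric Q) N) (w : V) : QuadraticMap.polar Q N.rep w = 0 := by
  by_contra hw
  set n := N.rep
  have hn : Q n ≠ 0 := hN.map_ne_zero
  have hli : LinearIndependent K ![n, w] := by
    refine (LinearIndependent.pair_iff' N.rep_nonzero).2 fun a ha => hw ?_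
    rw [← ha, QuadraticMap.polar_smul_right, polar_self_of_char_two, smul_zero]
  obtain ⟨X, hX⟩ := Set.ncard_eq_one.1 (hN.2 (Submodule.span K {n, w}) (finrank_span_pair hli)
    (mem_pts_iff.2 (Submodule.subset_span (by simp [n]))))
  have hXm : X ∈ quadric Q ∩ pts (Submodule.span K {n, w}) := by rw [hX]; rfl
  obtain ⟨a, b, hab⟩ := Submodule.mem_span_pair.1 (mem_pts_iff.1 hXm.2)
  have hQX : Q X.rep = 0 := hXm.1
  have hb : b ≠ 0 := by
    rintro rfl
    rw [zero_smul, add_zero] at hab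
    rw [← hab, QuadraticMap.map_smul] at hQX
    rcases mul_eq_zero.1 hQX with h | h
    · exact X.rep_nonzero (by rw [← hab, mul_self_eq_zero.1 h, zero_smul])
    · exact hn h
  have hpol : QuadraticMap.polar Q n X.rep = b * QuadraticMap.polar Q n w := by
    rw [← hab, QuadraticMap.polar_add_right, QuadraticMap.polar_smul_right,
      QuadraticMap.polar_smul_right, polar_self_of_char_two]
    simp
  set t : K := -(b * QuadraticMap.polar Q n w) / Q n with ht
  have ht0 : t ≠ 0 := div_ne_zero (neg_ne_zero.2 (mul_ne_zero hb hw)) hn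
  have hy : ∀ c : K, c • X.rep ≠ X.rep + t • n := by
    intro c hc
    have h1 : (t + (1 - c) * a) • n + ((1 - c) * b) • w = 0 := by
      have : (1 - c) • (a • n + b • w) + t • n = 0 := by
        rw [hab, sub_smul, hc, one_smul]
        abel
      rw [← this]
      module
    obtain ⟨h2, h3⟩ := LinearIndependent.pair_iff.1 hli _ _ h1
    have h4 : 1 - c = 0 := (mul_eq_zero.1 h3).resolve_right hb
    exact ht0 (by simpa [h4] using h2)
  have hy0 : X.rep + t • n ≠ 0 := fun h => hy 0 (by rw [h, zero_smul])
  have hQy : Q (X.rep + t • n) = 0 := by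
    rw [map_add_smul, hQX, hpol, ht]
    field_simp
    ring
  have hYm : Projectivization.mk K _ hy0 ∈ quadric Q ∩ pts (Submodule.span K {n, w}) := by
    refine ⟨(mk_mem_iff hy0).2 (mem_hat_quadric.2 ⟨hy0, hQy⟩), (mk_mem_pts hy0).2 ?_⟩
    exact Submodule.add_mem _ (mem_pts_iff.1 hXm.2)
      (Submodule.smul_mem _ _ (Submodule.subset_span (by simp)))
  rw [hX, Set.mem_singleton_iff] at hYm
  obtain ⟨c, hc⟩ := (Projectivization.mk_eq_mk_iff' K _ _ hy0 X.rep_nonzero).1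
    (hYm.trans X.mk_rep.symm)
  exact hy c hc

/-- The zeros of a non-singular ternary form span: no line contains all of them. -/
theorem exists_zero_polar_ne [Finite K] [CharP K 2] [Module.Finite K V] (hV : finrank K V = 3)
    {Q : QuadraticForm K V} (hQ : Nonsingular Q) {f : V →ₗ[K] K} (hf : f ≠ 0) :
    ∃ v, Q v = 0 ∧ f v ≠ 0 := by
  have := finite_of_finite_field (K := K) (V := V)
  by_contra! hc
  obtain ⟨n, hn0, hn⟩ := exists_polar_radical (by rw [hV]; decide) Q
  have hQn : Q n ≠ 0 := fun h => by
    obtain ⟨w, hw⟩ := hQ n hn0 h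
    exact hw (hn w)
  obtain ⟨u, hu⟩ : ∃ u, f u ≠ 0 := by
    by_contra! h
    exact hf (LinearMap.ext h)
  have h1 := ncard_zeros_of_radical Q (U := ⊤) trivial hQn (fun v _ => hn v)
  rw [finrank_top, hV, pow_succ'] at h1
  have h2 := Nat.eq_of_mul_eq_mul_left Nat.card_pos h1
  have h3 := finrank_inf_ker (U := ⊤) (f := f) (u := u) trivial hu
  rw [finrank_top, hV, top_inf_eq] at h3
  have h3 : finrank K (LinearMap.ker f) = 2 := by lia
  have h4 := ncard_submodule (LinearMap.ker f)
  rw [h3] at h4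
  -- Both sets have `q ^ 2` vectors. So `Q` vanishes on all of `ker f`, and every nonzero vector
  -- there is orthogonal to `ker f` and to `n`, hence singular.
  have h5 : {v | v ∈ (⊤ : Submodule K V) ∧ Q v = 0} = (LinearMap.ker f : Set V) :=
    Set.eq_of_subset_of_ncard_le (fun v hv => hc v hv.2) (by rw [h4, h2]) (Set.toFinite _)
  have h6 : ∀ v, f v = 0 → Q v = 0 := fun v hv => by
    have : v ∈ {v | v ∈ (⊤ : Submodule K V) ∧ Q v = 0} := by rw [h5]; exact hv
    exact this.2
  have hfn : f n ≠ 0 := fun h => hQn (h6 n h)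
  obtain ⟨a, ha, ha0⟩ : ∃ a ∈ LinearMap.ker f, a ≠ 0 := by
    refine (Submodule.ne_bot_iff _).1 fun h => ?_
    rw [h, finrank_bot] at h3
    lia
  obtain ⟨w, hw⟩ := hQ a ha0 (h6 a ha)
  apply hw
  have hm : f (w - (f w / f n) • n) = 0 := by simp [hfn]
  have hs : w = (w - (f w / f n) • n) + (f w / f n) • n := by simp
  rw [hs, QuadraticMap.polar_add_right, QuadraticMap.polar_smul_right, QuadraticMap.polar_comm Q a n,
    hn, smul_zero, add_zero, QuadraticMap.polar, h6 _ ha, h6 _ hm,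
    h6 _ (by rw [map_add, hm, LinearMap.mem_ker.1 ha, add_zero])]
  simp

/-- The lines from `P` to zeros in `μ` lie on the quadric, so these zeros are orthogonal to `p`.
They lie in the kernel of no nonzero functional on `μ`, so `p` is orthogonal to `μ`, hence to `H`,
and dimensions give equality with the kernel. -/
theorem IsSingularSolid.isTangentSolid [Finite K] [CharP K 2] [Module.Finite K V]
    (hV : finrank K V = 5) {Q : QuadraticForm K V} (hQ : Nonsingular Q) {N : ℙ K V}
    (hN : IsNucleus (quadric Q) N) {H : Submodule K V} {P : ℙ K V}
    (hH : IsSingularSolid Q H P) : IsTangentSolid Q H P.rep N.rep := by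
  obtain ⟨hH4, hPH, μ, hμH, hμ3, hPμ, hμQ, hcone⟩ := hH
  have hPμ' : P.rep ∉ μ := fun h => hPμ (mem_pts_iff.2 h)
  have hcone' : ∀ b ∈ μ, b ≠ 0 → Q b = 0 → ∀ s t : K, s • P.rep + t • b ≠ 0 →
      Q (s • P.rep + t • b) = 0 := by
    intro b hb hb0 hQb s t hne
    have : s • P.rep + t • b ∈ hat (quadric Q ∩ pts H) := by
      rw [hcone, mem_hat_cone]
      exact ⟨hne, b, mem_hat_inter_pts.2 ⟨mem_hat_quadric.2 ⟨hb0, hQb⟩, hb⟩, s, t, rfl⟩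
    exact (mem_hat_quadric.1 (mem_hat_inter_pts.1 this).1).2
  have hzero : ∀ f : μ →ₗ[K] K, f ≠ 0 → ∃ v ∈ μ, Q v = 0 ∧ v ≠ 0 ∧ ∀ hv : v ∈ μ, f ⟨v, hv⟩ ≠ 0 := by
    intro f hf
    obtain ⟨v, hv, hfv⟩ := exists_zero_polar_ne hμ3 hμQ hf
    refine ⟨v, v.2, hv, ?_, fun _ => hfv⟩
    intro h
    exact hfv (by rw [show v = 0 from Subtype.ext h, map_zero])
  have hQP : Q P.rep = 0 := by
    have : Nontrivial μ := Module.nontrivial_of_finrank_pos (R := K) (by lia)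
    obtain ⟨f, hf⟩ := exists_ne (0 : μ →ₗ[K] K)
    obtain ⟨v, hv, hQv, hv0, -⟩ := hzero f hf
    simpa using hcone' v hv hv0 hQv 1 0 (by simpa using P.rep_nonzero)
  have hpolμ : ∀ v ∈ μ, QuadraticMap.polar Q P.rep v = 0 := by
    by_contra! hc
    obtain ⟨w, hw, hpw⟩ := hc
    obtain ⟨v, hv, hQv, hv0, hfv⟩ := hzero ((Q.polarBilin P.rep).comp μ.subtype) fun h => hpw
      (by simpa using LinearMap.congr_fun h ⟨w, hw⟩)
    apply hfv hv
    have hne : (1 : K) • P.rep + (1 : K) • v ≠ 0 := fun h => hPμ' (by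
      rw [one_smul, one_smul] at h
      rw [eq_neg_of_add_eq_zero_left h]
      exact μ.neg_mem hv)
    have := hcone' v hv hv0 hQv 1 1 hne
    rw [one_smul, one_smul] at this
    simp [QuadraticMap.polar, this, hQP, hQv]
  have hpolH : ∀ v ∈ H, QuadraticMap.polar Q P.rep v = 0 := by
    intro v hv
    obtain ⟨t, ht, -⟩ := existsUnique_add_smul_mem hμH (by rw [hμ3, hH4]) (mem_pts_iff.1 hPH) hPμ' hv
    have := hpolμ _ ht
    rwa [QuadraticMap.polar_add_right, QuadraticMap.polar_smul_right, polar_self_of_char_two,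
      smul_zero, add_zero] at this
  have hker : H = LinearMap.ker (Q.polarBilin P.rep) := by
    refine eq_of_le_of_finrank_eq (fun v hv => by simpa using hpolH v hv) ?_
    obtain ⟨w, hw⟩ := hQ _ P.rep_nonzero hQP
    have := finrank_inf_ker (U := ⊤) (f := Q.polarBilin P.rep) (u := w) trivial (by simpa using hw)
    rw [top_inf_eq, finrank_top, hV] at this
    lia
  exact
    { finrank_eq := hV
      nonsingular := hQ
      finrank_solid := hH4
      ne_zero := P.rep_nonzero
      map_vertex := hQP
      mem_solid := fun v => by 
        conv_lhs => rw [hker, LinearMap.mem_ker, QuadraticMap.polarBilin_apply_apply]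
      map_nucleus := hN.map_ne_zero
      polar_nucleus := hN.polar_eq_zero }

end TangentSolid

/-! ### Truncated cones, and the plane sections of the four configurations. -/

section Cones

variable {K V : Type*} [Field K] [AddCommGroup V] [Module K V]

/-- `D` is a union of lines through the point spanned by `p`, that point removed. -/
def IsPunctured (p : V) (D : Set (ℙ K V)) : Prop := ∀ v ∈ hat D, ∀ t : K, v + t • p ∈ hat D

theorem IsPunctured.inter_pts {p : V} {D : Set (ℙ K V)} (hD : IsPunctured p D) {α : Submodule K V}
    (hp : p ∈ α) : IsPunctured p (D ∩ pts α) := by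
  intro v hv t
  rw [mem_hat_inter_pts] at hv ⊢
  exact ⟨hD v hv.1 t, α.add_mem hv.2 (α.smul_mem t hp)⟩

/-- Every hyperplane of `H` missing `p` is a transversal to the lines through `p`, so it gets the
same share of `D`. -/
theorem IsPunctured.card_mul_ncard [Finite K] [Module.Finite K V] {p : V} {D : Set (ℙ K V)}
    (hD : IsPunctured p D) {α H : Submodule K V} (hDH : D ⊆ pts H) (hα : α ≤ H)
    (hαH : finrank K α + 1 = finrank K H) (hpH : p ∈ H) (hp : p ∉ α) :
    Nat.card K * (D ∩ pts α).ncard = D.ncard := by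
  have := finite_of_finite_field (K := K) (V := V)
  have h := card_mul_ncard_of_translate (D := hat D) (Z := (α : Set V)) hD (fun v hv =>
    existsUnique_add_smul_mem hα hαH hpH hp (by
      obtain ⟨hv0, hv⟩ := hv
      exact (mk_mem_pts hv0).1 (hDH hv)))
  rw [← hat_inter_pts, ncard_hat, ncard_hat, mul_left_comm] at h
  exact Nat.eq_of_mul_eq_mul_left (Nat.sub_pos_of_lt one_lt_card_field) h

theorem mem_hat_truncatedCone {P : ℙ K V} {μ : Submodule K V} (hP : P ∉ pts μ) {A : Set (ℙ K V)}
    (hA : A ⊆ pts μ) {v : V} :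
    v ∈ hat (truncatedCone P A) ↔ ∃ b ∈ hat A, ∃ s : K, v = b + s • P.rep := by
  have hPμ : P.rep ∉ μ := fun h => hP (mem_pts_iff.2 h)
  constructor
  · rintro ⟨hv, hc, hvP⟩
    obtain ⟨-, b, hb, s, t, h⟩ := mem_hat_cone.1 ⟨hv, hc⟩
    refine ⟨t • b, (smul_mem_hat ?_).2 hb, s, by rw [h, add_comm]⟩
    rintro rfl
    apply hvP
    rw [Set.mem_singleton_iff, ← P.mk_rep, Projectivization.mk_eq_mk_iff']
    exact ⟨s, by rw [h]; simp⟩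
  · rintro ⟨b, hb, s, rfl⟩
    have hbμ : b ∈ μ := by
      obtain ⟨hb0, hb⟩ := hb
      exact (mk_mem_pts hb0).1 (hA hb)
    have key : ∀ c : K, c • P.rep ≠ b + s • P.rep := by
      intro c hc
      have h1 : b = (c - s) • P.rep := by rw [sub_smul, hc, add_sub_cancel_right]
      have h2 : c - s ≠ 0 := fun h0 => ne_zero_of_mem_hat hb (by rw [h1, h0, zero_smul])
      rw [h1, Submodule.smul_mem_iff _ h2] at hbμ
      exact hPμ hbμ
    have hne : b + s • P.rep ≠ 0 := fun h => key 0 (by rw [h, zero_smul])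
    obtain ⟨_, hcone⟩ := mem_hat_cone.2 ⟨hne, b, hb, s, 1, by rw [one_smul, add_comm]⟩
    refine ⟨hne, hcone, fun h => ?_⟩
    obtain ⟨c, hc⟩ := (Projectivization.mk_eq_mk_iff' K _ _ hne P.rep_nonzero).1
      ((Set.mem_singleton_iff.1 h).trans P.mk_rep.symm)
    exact key c hc

theorem isPunctured_truncatedCone {P : ℙ K V} {μ : Submodule K V} (hP : P ∉ pts μ)
    {A : Set (ℙ K V)} (hA : A ⊆ pts μ) : IsPunctured P.rep (truncatedCone P A) := by
  intro v hv t
  rw [mem_hat_truncatedCone hP hA] at hv ⊢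
  obtain ⟨b, hb, s, rfl⟩ := hv
  exact ⟨b, hb, s + t, by rw [add_smul, add_assoc]⟩

theorem mem_of_mem_hat {T : Set (ℙ K V)} {U : Submodule K V} (hT : T ⊆ pts U) {v : V}
    (hv : v ∈ hat T) : v ∈ U := by
  obtain ⟨hv0, hv⟩ := hv
  exact (mk_mem_pts hv0).1 (hT hv)

theorem subset_pts_of_hat {T : Set (ℙ K V)} {U : Submodule K V} (h : ∀ v ∈ hat T, v ∈ U) :
    T ⊆ pts U := fun _ hX => mem_pts_iff.2 (h _ (rep_mem_hat.2 hX))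

theorem truncatedCone_subset {P : ℙ K V} {μ H : Submodule K V} (hμ : μ ≤ H) (hPH : P ∈ pts H)
    (hP : P ∉ pts μ) {A : Set (ℙ K V)} (hA : A ⊆ pts μ) : truncatedCone P A ⊆ pts H := by
  refine subset_pts_of_hat fun v hv => ?_
  obtain ⟨b, hb, s, rfl⟩ := (mem_hat_truncatedCone hP hA).1 hv
  exact H.add_mem (hμ (mem_of_mem_hat hA hb)) (H.smul_mem s (mem_pts_iff.1 hPH))

theorem truncatedCone_inter_pts {P : ℙ K V} {μ : Submodule K V} (hP : P ∉ pts μ)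
    {A : Set (ℙ K V)} (hA : A ⊆ pts μ) : truncatedCone P A ∩ pts μ = A := by
  refine set_eq_of_hat_eq fun v => ?_
  rw [mem_hat_inter_pts]
  constructor
  · rintro ⟨hv, hvμ⟩
    obtain ⟨b, hb, s, rfl⟩ := (mem_hat_truncatedCone hP hA).1 hv
    have h1 : s • P.rep ∈ μ := (Submodule.add_mem_iff_right μ (mem_of_mem_hat hA hb)).1 hvμ
    have h2 : s = 0 := by
      by_contra hs
      exact hP (mem_pts_iff.2 ((Submodule.smul_mem_iff _ hs).1 h1))
    simpa [h2] using hb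
  · intro hv
    exact ⟨(mem_hat_truncatedCone hP hA).2 ⟨v, hv, 0, by simp⟩, mem_of_mem_hat hA hv⟩

theorem IsPunctured.eq_truncatedCone [Module.Finite K V] {P : ℙ K V} {D : Set (ℙ K V)}
    (hD : IsPunctured P.rep D) {μ H : Submodule K V} (hDH : D ⊆ pts H) (hμ : μ ≤ H)
    (hμH : finrank K μ + 1 = finrank K H) (hPH : P ∈ pts H) (hP : P ∉ pts μ) :
    D = truncatedCone P (D ∩ pts μ) := by
  refine set_eq_of_hat_eq fun v => ?_
  rw [mem_hat_truncatedCone hP Set.inter_subset_right]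
  constructor
  · intro hv
    obtain ⟨t, ht, -⟩ := existsUnique_add_smul_mem hμ hμH (mem_pts_iff.1 hPH)
      (fun h => hP (mem_pts_iff.2 h)) (mem_of_mem_hat hDH hv)
    exact ⟨v + t • P.rep, mem_hat_inter_pts.2 ⟨hD v hv t, ht⟩, -t, by simp⟩
  · rintro ⟨b, hb, s, rfl⟩
    exact hD b (mem_hat_inter_pts.1 hb).1 s

theorem pts_inf (U W : Submodule K V) : pts (U ⊓ W) = pts U ∩ pts W := by
  ext X
  simp [mem_pts_iff]

theorem cone_eq_insert {P : ℙ K V} {B : Set (ℙ K V)} (hB : B.Nonempty) :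
    cone P B = insert P (truncatedCone P B) := by
  rw [truncatedCone, Set.insert_sdiff_singleton, Set.insert_eq_of_mem]
  obtain ⟨b, hb⟩ := hB
  exact ⟨b, hb, (show P.submodule ≤ _ from le_sup_left)⟩

theorem vertex_notMem_truncatedCone {P : ℙ K V} {B : Set (ℙ K V)} : P ∉ truncatedCone P B :=
  fun h => h.2 rfl

theorem HasPlaneSizes.symm {H : Submodule K V} {p n : V} {T : Set (ℙ K V)}
    (h : HasPlaneSizes H p n T) : HasPlaneSizes H n p T :=
  ⟨h.subset, h.ncard_eq, h.plane, fun α hα hα3 hn hp => h.plane_of_notMem α hα hα3 hp hn⟩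

theorem submodule_sup_eq_span (P N : ℙ K V) :
    P.submodule ⊔ N.submodule = Submodule.span K {P.rep, N.rep} := by
  rw [Projectivization.submodule_eq, Projectivization.submodule_eq, Submodule.span_insert]

variable [Finite K] [Module.Finite K V]

theorem ncard_pts_line {l : Submodule K V} (hl : finrank K l = 2) :
    (pts l).ncard = Nat.card K + 1 := by
  have := ncard_pts l
  rw [hl] at this
  refine eq_of_sub_one_mul_eq (K := K) ?_
  zify [cast_card_sub_one] at this
  push_cast
  linear_combination this

theorem ncard_pts_point {l : Submodule K V} (hl : finrank K l = 1) : (pts l).ncard = 1 := by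
  have := ncard_pts l
  rw [hl] at this
  refine eq_of_sub_one_mul_eq (K := K) ?_
  zify [cast_card_sub_one] at this
  push_cast
  linear_combination this

/-- The vertex `P`, the base plane `μ` and a base in `μ` of a cone in the solid `H`. -/
structure IsConeBase (H : Submodule K V) (P : ℙ K V) (μ : Submodule K V) (A : Set (ℙ K V)) :
    Prop where
  finrank_solid : finrank K H = 4
  vertex_mem : P ∈ pts H
  le : μ ≤ H
  finrank_plane : finrank K μ = 3
  vertex_notMem : P ∉ pts μ
  subset : A ⊆ pts μ

namespace IsConeBase

variable {H : Submodule K V} {P : ℙ K V} {μ : Submodule K V} {A : Set (ℙ K V)}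

theorem ncard_truncatedCone (h : IsConeBase H P μ A) :
    (truncatedCone P A).ncard = Nat.card K * A.ncard := by
  rw [← (isPunctured_truncatedCone h.vertex_notMem h.subset).card_mul_ncard
    (truncatedCone_subset h.le h.vertex_mem h.vertex_notMem h.subset) h.le
    (by rw [h.finrank_plane, h.finrank_solid]) (mem_pts_iff.1 h.vertex_mem)
    (fun hc => h.vertex_notMem (mem_pts_iff.2 hc)),
    truncatedCone_inter_pts h.vertex_notMem h.subset]

theorem ncard_truncatedCone_inter_of_notMem (h : IsConeBase H P μ A) {α : Submodule K V}
    (hα : α ≤ H) (hα3 : finrank K α = 3) (hP : P.rep ∉ α) :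
    (truncatedCone P A ∩ pts α).ncard = A.ncard := by
  have := (isPunctured_truncatedCone h.vertex_notMem h.subset).card_mul_ncard
    (truncatedCone_subset h.le h.vertex_mem h.vertex_notMem h.subset) hα
    (by rw [hα3, h.finrank_solid]) (mem_pts_iff.1 h.vertex_mem) hP
  rw [h.ncard_truncatedCone] at this
  exact Nat.eq_of_mul_eq_mul_left Nat.card_pos this

theorem ncard_truncatedCone_inter_of_mem (h : IsConeBase H P μ A) {α : Submodule K V}
    (hP : P.rep ∈ α) :
    (truncatedCone P A ∩ pts α).ncard = Nat.card K * (A ∩ pts α).ncard := by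
  rw [← ((isPunctured_truncatedCone h.vertex_notMem h.subset).inter_pts hP).card_mul_ncard
    (Set.inter_subset_left.trans
      (truncatedCone_subset h.le h.vertex_mem h.vertex_notMem h.subset)) h.le
    (by rw [h.finrank_plane, h.finrank_solid]) (mem_pts_iff.1 h.vertex_mem)
    (fun hc => h.vertex_notMem (mem_pts_iff.2 hc)),
    Set.inter_right_comm, truncatedCone_inter_pts h.vertex_notMem h.subset]

/-- A plane through the vertex cuts the base plane in a line, to which the arc property applies. -/
theorem ncard_inter_le_two (h : IsConeBase H P μ A) {k : ℕ} (hA : IsArc μ k A)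
    {α : Submodule K V} (hα : α ≤ H) (hα3 : finrank K α = 3) (hP : P.rep ∈ α) :
    (A ∩ pts α).ncard ≤ 2 := by
  have := finite_projectivization (K := K) (V := V)
  have h1 := Submodule.finrank_sup_add_finrank_inf_eq α μ
  have h2 := Submodule.finrank_mono (sup_le hα h.le)
  have h3 : finrank K ↥(α ⊓ μ) ≤ 3 := hα3 ▸ Submodule.finrank_mono inf_le_left
  have h4 : finrank K ↥(α ⊓ μ) ≠ 3 := by
    intro hc
    have h5 := eq_of_le_of_finrank_eq (inf_le_left : α ⊓ μ ≤ α) (by rw [hc, hα3])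
    exact h.vertex_notMem (mem_pts_iff.2 (inf_eq_left.1 h5 hP))
  rw [hα3, h.finrank_plane] at h1
  rw [h.finrank_solid] at h2
  have h6 : A ∩ pts α = A ∩ pts (α ⊓ μ) := by
    rw [pts_inf]
    ext X
    exact ⟨fun hX => ⟨hX.1, hX.2, h.subset hX.1⟩, fun hX => ⟨hX.1, hX.2.1⟩⟩
  rw [h6]
  exact hA.2.2.2 _ (by lia)

end IsConeBase

/-- A plane missing the vertex is a transversal with `q + 1` points; one through it has the vertex
and `q` points for each of at most two base points. The vector `n` is arbitrary here. -/
theorem IsOvalCone.hasPlaneSizes {H : Submodule K V} (hH : finrank K H = 4) {P : ℙ K V}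
    (hP : P ∈ pts H) (n : V) {T : Set (ℙ K V)} (hT : IsOvalCone H P T) :
    HasPlaneSizes H P.rep n T := by
  have := finite_projectivization (K := K) (V := V)
  obtain ⟨μ, O, hμ, hPμ, hO, rfl⟩ := hT
  have h : IsConeBase H P μ O := ⟨hH, hP, hμ, hO.1, hPμ, hO.2.1⟩
  have hcard : O.ncard = Nat.card K + 1 := hO.2.2.1
  have hne : O.Nonempty := Set.nonempty_of_ncard_ne_zero (by lia)
  have hnot : ∀ α ≤ H, finrank K α = 3 → P.rep ∉ α →
      (cone P O ∩ pts α).ncard = Nat.card K + 1 := by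
    intro α hα hα3 hPα
    rw [cone_eq_insert hne, Set.insert_inter_of_notMem (fun hc => hPα (mem_pts_iff.1 hc)),
      h.ncard_truncatedCone_inter_of_notMem hα hα3 hPα, hcard]
  refine ⟨?_, ?_, fun α hα hα3 => ?_, fun α hα hα3 hPα _ => hnot α hα hα3 hPα⟩
  · rw [cone_eq_insert hne]
    exact Set.insert_subset hP (truncatedCone_subset hμ hP hPμ hO.2.1)
  · rw [cone_eq_insert hne, Set.ncard_insert_of_notMem vertex_notMem_truncatedCone,
      h.ncard_truncatedCone, hcard]
    ring
  · by_cases hPα : P.rep ∈ α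
    · rw [cone_eq_insert hne, Set.insert_inter_of_mem (mem_pts_iff.2 hPα),
        Set.ncard_insert_of_notMem (fun hc => vertex_notMem_truncatedCone hc.1),
        h.ncard_truncatedCone_inter_of_mem hPα]
      have := h.ncard_inter_le_two hO hα hα3 hPα
      interval_cases (O ∩ pts α).ncard <;> lia
    · exact Or.inr (Or.inl (hnot α hα hα3 hPα))

/-- Add the sections of the truncated cone and of `l`. A plane missing `N` cannot contain `l`, so if
it also misses `P` it has `q + 1` points. -/
theorem IsTruncatedArcConeWithLine.hasPlaneSizes {H : Submodule K V} (hH : finrank K H = 4)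
    {P N : ℙ K V} (hP : P ∈ pts H) (hPN : LinearIndependent K ![P.rep, N.rep]) {T : Set (ℙ K V)}
    (hT : IsTruncatedArcConeWithLine H P N T) : HasPlaneSizes H P.rep N.rep T := by
  have := finite_projectivization (K := K) (V := V)
  obtain ⟨μ, A, l, hμ, hPμ, hA, hl, hl2, hNl, hlne, hdisj, rfl⟩ := hT
  have h : IsConeBase H P μ A := ⟨hH, hP, hμ, hA.1, hPμ, hA.2.1⟩
  have hcard : A.ncard = Nat.card K := hA.2.2.1
  have hPl : P.rep ∉ l := by
    intro hPl
    apply hlne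
    rw [submodule_sup_eq_span]
    refine (eq_of_le_of_finrank_eq (Submodule.span_le.2 ?_) ?_).symm
    · rintro x (rfl | rfl)
      · exact hPl
      · exact mem_pts_iff.1 hNl
    · rw [finrank_span_pair hPN, hl2]
  have hsplit : ∀ α : Submodule K V, ((truncatedCone P A ∪ pts l) ∩ pts α).ncard
      = (truncatedCone P A ∩ pts α).ncard + (pts (l ⊓ α)).ncard := by
    intro α
    rw [Set.union_inter_distrib_right, Set.ncard_union_eq, pts_inf]
    exact hdisj.mono Set.inter_subset_left Set.inter_subset_left
  have hline : ∀ α ≤ H, finrank K α = 3 → ¬ l ≤ α → (pts (l ⊓ α)).ncard = 1 := by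
    intro α hα hα3 hle
    refine ncard_pts_point ?_
    have h1 := Submodule.finrank_sup_add_finrank_inf_eq l α
    have h2 := Submodule.finrank_mono (sup_le hl hα)
    have h3 : finrank K ↥(l ⊓ α) ≤ 2 := hl2 ▸ Submodule.finrank_mono inf_le_left
    have h4 : finrank K ↥(l ⊓ α) ≠ 2 := fun hc =>
      hle (inf_eq_left.1 (eq_of_le_of_finrank_eq (inf_le_left : l ⊓ α ≤ l) (by rw [hc, hl2])))
    lia
  have hline' : ∀ α : Submodule K V, l ≤ α → (pts (l ⊓ α)).ncard = Nat.card K + 1 := by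
    intro α hle
    rw [inf_eq_left.2 hle]
    exact ncard_pts_line hl2
  refine ⟨?_, ?_, fun α hα hα3 => ?_, fun α hα hα3 hPα hNα => ?_⟩
  · refine Set.union_subset (truncatedCone_subset hμ hP hPμ hA.2.1) fun X hX => ?_
    exact mem_pts_iff.2 (hl (mem_pts_iff.1 hX))
  · rw [Set.ncard_union_eq hdisj, h.ncard_truncatedCone, hcard, ncard_pts_line hl2]
    ring
  · rw [hsplit]
    by_cases hPα : P.rep ∈ α
    · rw [h.ncard_truncatedCone_inter_of_mem hPα]
      by_cases hle : l ≤ α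
      -- For a base point `X` in the plane, the line `PX` would meet `l` in a point other than `P`,
      -- against disjointness.
      · have : A ∩ pts α = ∅ := by
          rw [Set.eq_empty_iff_forall_notMem]
          rintro X ⟨hXA, hXα⟩
          obtain ⟨t, ht, -⟩ := existsUnique_add_smul_mem hle (by rw [hl2, hα3]) hPα hPl
            (mem_pts_iff.1 hXα)
          obtain ⟨h0, hm⟩ := (mem_hat_truncatedCone hPμ hA.2.1).2 ⟨_, rep_mem_hat.2 hXA, t, rfl⟩
          exact Set.disjoint_left.1 hdisj hm ((mk_mem_pts h0).2 ht)
        rw [this, hline' α hle]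
        simp
      · rw [hline α hα hα3 hle]
        have := h.ncard_inter_le_two hA hα hα3 hPα
        interval_cases (A ∩ pts α).ncard <;> lia
    · rw [h.ncard_truncatedCone_inter_of_notMem hα hα3 hPα, hcard]
      by_cases hle : l ≤ α
      · rw [hline' α hle]
        lia
      · rw [hline α hα hα3 hle]
        lia
  · rw [hsplit, h.ncard_truncatedCone_inter_of_notMem hα hα3 hPα, hcard,
      hline α hα hα3 fun hle => hNα (hle (mem_pts_iff.1 hNl))]

end Cones

/-! ### Line sections in the planes through `p` and `n`. -/

section Classification

variable {K V : Type*} [Field K] [AddCommGroup V] [Module K V]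

/-- A set with the plane intersection sizes of `HasPlaneSizes`, together with the position of the
two points spanned by `p` and `n`. -/
structure IsSwitchingSet (H : Submodule K V) (p n : V) (T : Set (ℙ K V)) : Prop extends
    HasPlaneSizes H p n T where
  finrank_solid : finrank K H = 4
  linearIndependent : LinearIndependent K ![p, n]
  mem_left : p ∈ H
  mem_right : n ∈ H

open Classical in
theorem ncard_inter_span_singleton {T : Set (ℙ K V)} {x : V} (hx : x ≠ 0) :
    (T ∩ pts (Submodule.span K {x})).ncard = if x ∈ hat T then 1 else 0 := by
  have h : pts (Submodule.span K {x}) = {Projectivization.mk K x hx} := by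
    ext X
    rw [mem_pts_iff, Submodule.mem_span_singleton, Set.mem_singleton_iff, ← X.mk_rep,
      Projectivization.mk_eq_mk_iff', X.mk_rep]
  rw [h]
  split_ifs with hT
  · rw [Set.inter_eq_self_of_subset_right (Set.singleton_subset_iff.2 ((mk_mem_iff hx).2 hT)),
      Set.ncard_singleton]
  · rw [Set.inter_singleton_eq_empty.2 (fun hc => hT ((mk_mem_iff hx).1 hc)), Set.ncard_empty]

theorem linearIndependent_triple {p n x : V} (h : LinearIndependent K ![p, n])
    (hx : x ∉ Submodule.span K {p, n}) : LinearIndependent K ![x, p, n] := by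
  refine linearIndependent_finCons.2 ⟨h, ?_⟩
  rwa [Matrix.range_cons_cons_empty]

theorem finrank_span_triple {p n x : V} (h : LinearIndependent K ![x, p, n]) :
    finrank K (Submodule.span K {p, n, x}) = 3 := by
  have := finrank_span_eq_card h
  rw [Fintype.card_fin] at this
  have hs : ({p, n, x} : Set V) = Set.range ![x, p, n] := by
    ext v
    simp only [Set.mem_insert_iff, Set.mem_singleton_iff, Set.mem_range, Fin.exists_fin_succ,
      Matrix.cons_val_zero, Matrix.cons_val_succ, IsEmpty.exists_iff, or_false, eq_comm (b := v)]
    tauto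
  rw [hs, this]

namespace IsSwitchingSet

variable {H : Submodule K V} {p n : V} {T : Set (ℙ K V)}

theorem symm (h : IsSwitchingSet H p n T) : IsSwitchingSet H n p T :=
  { h.toHasPlaneSizes.symm with
    finrank_solid := h.finrank_solid
    linearIndependent := LinearIndependent.pair_symm_iff.1 h.linearIndependent
    mem_left := h.mem_right
    mem_right := h.mem_left }

theorem span_le (h : IsSwitchingSet H p n T) : Submodule.span K {p, n} ≤ H := by
  refine Submodule.span_le.2 ?_
  rintro x (rfl | rfl)
  · exact h.mem_left
  · exact h.mem_right

theorem exists_functional (h : IsSwitchingSet H p n T) (a b : K) :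
    ∃ f : V →ₗ[K] K, f p = a ∧ f n = b := by
  obtain ⟨f, hf⟩ := exists_functional_eq h.linearIndependent ![a, b]
  exact ⟨f, hf 0, hf 1⟩

theorem exists_functional_of_notMem [Module.Finite K V] (h : IsSwitchingSet H p n T) {x : V} (hx : x ∈ H)
    (hxL : x ∉ Submodule.span K {p, n}) :
    ∃ d : V →ₗ[K] K, Submodule.span K {p, n, x} = H ⊓ LinearMap.ker d := by
  have hle : Submodule.span K {p, n, x} ≤ H := by
    refine Submodule.span_le.2 ?_
    rintro y (rfl | rfl | rfl)
    · exact h.mem_left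
    · exact h.mem_right
    · exact hx
  have h3 := finrank_span_triple (linearIndependent_triple h.linearIndependent hxL)
  have h4 := h.finrank_solid
  obtain ⟨u, hu, huW⟩ := exists_mem_notMem_of_finrank_lt
    (A := Submodule.span K {p, n, x}) (B := H) (by lia)
  obtain ⟨d, -, hd⟩ := exists_eq_inf_ker hle (by lia) hu huW
  exact ⟨d, hd⟩

variable [Finite K] [Module.Finite K V]

/-- Take the pencil with members cut out by `d` and by `f - t • d`. The latter agree with `f` at `p`
and `n`, so they are planes missing both points, of size `q + 1`. In a plane through `p` and `n`,
every line missing them therefore has the same size. -/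
theorem ncard_inter_ker (h : IsSwitchingSet H p n T) {d f : V →ₗ[K] K} (hdp : d p = 0)
    (hdn : d n = 0) (hfp : f p ≠ 0) (hfn : f n ≠ 0) :
    (T ∩ pts (H ⊓ LinearMap.ker d)).ncard
      = 1 + Nat.card K * (T ∩ pts (H ⊓ LinearMap.ker d ⊓ LinearMap.ker f)).ncard := by
  have := Fintype.ofFinite K
  have pencil := ncard_pencil T H d f
  have hT : T ∩ pts H = T := Set.inter_eq_self_of_subset_left h.subset
  have hs : ∀ t : K, (T ∩ pts (H ⊓ LinearMap.ker (f - t • d))).ncard = Nat.card K + 1 := by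
    intro t
    have hp : (f - t • d) p ≠ 0 := by simpa [hdp] using hfp
    have hn : (f - t • d) n ≠ 0 := by simpa [hdn] using hfn
    refine h.plane_of_notMem _ inf_le_left ?_ (fun hc => hp hc.2) (fun hc => hn hc.2)
    have := finrank_inf_ker h.mem_left hp
    have := h.finrank_solid
    lia
  simp only [hs, hT, h.ncard_eq, Finset.sum_const, Finset.card_univ, smul_eq_mul,
    ← Nat.card_eq_fintype_card] at pencil
  nlinarith

open Classical in
/-- In a plane through `p` and `n`, the lines through a point `x` that contain neither `p` nor `n`
all have the same size, which determines the sum of the sizes of the other two. -/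
theorem ncard_add_ncard (h : IsSwitchingSet H p n T) {x : V} (hx : x ∈ H)
    (hxL : x ∉ Submodule.span K {p, n}) :
    Nat.card K * ((T ∩ pts (Submodule.span K {p, x})).ncard
        + (T ∩ pts (Submodule.span K {n, x})).ncard) + 1
      = Nat.card K + (T ∩ pts (Submodule.span K {p, n, x})).ncard
        + Nat.card K ^ 2 * if x ∈ hat T then 1 else 0 := by
  have := Fintype.ofFinite K
  have hli := linearIndependent_triple h.linearIndependent hxL
  have hx0 : x ≠ 0 := fun h0 => hxL (by simp [h0])
  obtain ⟨d, hd⟩ := h.exists_functional_of_notMem hx hxL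
  have hdp : d p = 0 := by
    have : p ∈ H ⊓ LinearMap.ker d := by
      rw [← hd]
      exact Submodule.subset_span (by simp)
    exact this.2
  have hdn : d n = 0 := by
    have : n ∈ H ⊓ LinearMap.ker d := by
      rw [← hd]
      exact Submodule.subset_span (by simp)
    exact this.2
  obtain ⟨a, ha⟩ := exists_functional_eq hli ![0, 1, 0]
  obtain ⟨b, hb⟩ := exists_functional_eq hli ![0, 0, 1]
  have hax : a x = 0 := ha 0
  have hap : a p = 1 := ha 1
  have han : a n = 0 := ha 2
  have hbx : b x = 0 := hb 0
  have hbp : b p = 0 := hb 1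
  have hbn : b n = 1 := hb 2
  have hWb : H ⊓ LinearMap.ker d ⊓ LinearMap.ker (b - (0 : K) • a) = Submodule.span K {p, x} := by
    rw [← hd]
    ext v
    simp only [Submodule.mem_inf, Submodule.mem_span_triple, Submodule.mem_span_pair,
      LinearMap.mem_ker]
    constructor
    · rintro ⟨⟨r, s, t, rfl⟩, hv⟩
      have : s = 0 := by simpa [hbx, hbp, hbn] using hv
      exact ⟨r, t, by simp [this]⟩
    · rintro ⟨r, t, rfl⟩
      exact ⟨⟨r, 0, t, by simp⟩, by simp [hbx, hbp]⟩
  have hWa : H ⊓ LinearMap.ker d ⊓ LinearMap.ker a = Submodule.span K {n, x} := by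
    rw [← hd]
    ext v
    simp only [Submodule.mem_inf, Submodule.mem_span_triple, Submodule.mem_span_pair,
      LinearMap.mem_ker]
    constructor
    · rintro ⟨⟨r, s, t, rfl⟩, hv⟩
      have : r = 0 := by simpa [hax, hap, han] using hv
      exact ⟨s, t, by simp [this]⟩
    · rintro ⟨s, t, rfl⟩
      exact ⟨⟨0, s, t, by simp⟩, by simp [hax, han]⟩
  have hWab : H ⊓ LinearMap.ker d ⊓ LinearMap.ker a ⊓ LinearMap.ker b = Submodule.span K {x} := by
    rw [hWa]
    ext v
    simp only [Submodule.mem_inf, Submodule.mem_span_singleton, Submodule.mem_span_pair,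
      LinearMap.mem_ker]
    constructor
    · rintro ⟨⟨s, t, rfl⟩, hv⟩
      have : s = 0 := by simpa [hbx, hbn] using hv
      exact ⟨t, by simp [this]⟩
    · rintro ⟨t, rfl⟩
      exact ⟨⟨0, t, by simp⟩, by simp [hbx]⟩
  have pencil := ncard_pencil T (H ⊓ LinearMap.ker d) a b
  rw [hWab, ncard_inter_span_singleton hx0, hWa, ← Finset.add_sum_erase _ _ (Finset.mem_univ 0),
    hWb] at pencil
  -- In the pencil of lines through `x`, the value `t = 0` gives the line `px` and `ker a` gives
  -- `nx`; the other `q - 1` lines miss both points.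
  have hs : ∀ t ∈ Finset.univ.erase (0 : K), Nat.card K *
      (T ∩ pts (H ⊓ LinearMap.ker d ⊓ LinearMap.ker (b - t • a))).ncard + 1
        = (T ∩ pts (H ⊓ LinearMap.ker d)).ncard := by
    intro t ht
    rw [h.ncard_inter_ker hdp hdn (f := b - t • a)
      (by simpa [hbp, hap] using Finset.ne_of_mem_erase ht) (by simp [hbn, han]), add_comm]
  have hsum := Finset.sum_congr rfl hs
  rw [Finset.sum_add_distrib, ← Finset.mul_sum, Finset.sum_const, Finset.sum_const,
    Finset.card_erase_of_mem (Finset.mem_univ _), Finset.card_univ, ← Nat.card_eq_fintype_card,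
    smul_eq_mul, smul_eq_mul] at hsum
  rw [hd]
  zify [cast_card_sub_one] at pencil hsum ⊢
  linear_combination (Nat.card K : ℤ) * pencil - hsum

end IsSwitchingSet
end Classification

/-! ### The line `pn`, and the ruling of each plane through it. -/

section Split

variable {K V : Type*} [Field K] [AddCommGroup V] [Module K V]

/-- `T` is a union of lines through `p` in the plane through `p`, `n` and `x`, up to points of the
line through `p` and `n`. -/
def IsRuledAt (T : Set (ℙ K V)) (p n x : V) : Prop :=
  ∀ a a' b : K, x + a • p + b • n ∈ hat T → x + a' • p + b • n ∈ hat T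

theorem span_add_smul_left (p x : V) (a : K) :
    Submodule.span K {p, x + a • p} = Submodule.span K {p, x} := by
  ext v
  simp only [Submodule.mem_span_pair]
  constructor
  · rintro ⟨r, s, rfl⟩
    exact ⟨r + s * a, s, by module⟩
  · rintro ⟨r, s, rfl⟩
    exact ⟨r - s * a, s, by module⟩

namespace IsSwitchingSet

variable {H : Submodule K V} {p n : V} {T : Set (ℙ K V)}

theorem left_ne_zero (h : IsSwitchingSet H p n T) : p ≠ 0 := h.linearIndependent.ne_zero 0

theorem right_ne_zero (h : IsSwitchingSet H p n T) : n ≠ 0 := h.linearIndependent.ne_zero 1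

theorem add_smul_ne_zero (h : IsSwitchingSet H p n T) (s : K) : p + s • n ≠ 0 := by
  intro h0
  have := (LinearIndependent.pair_iff.1 h.linearIndependent 1 s (by simpa using h0)).1
  exact one_ne_zero this

theorem span_inf_ker {f : V →ₗ[K] K} {s : K}
    (hp : f p = -s) (hn : f n = 1) :
    Submodule.span K {p, n} ⊓ LinearMap.ker f = Submodule.span K {p + s • n} := by
  ext v
  simp only [Submodule.mem_inf, Submodule.mem_span_pair, Submodule.mem_span_singleton,
    LinearMap.mem_ker]
  constructor
  · rintro ⟨⟨a, b, rfl⟩, hv⟩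
    have hb : b = a * s := by
      simp only [map_add, map_smul, hp, hn, smul_eq_mul] at hv
      linear_combination hv
    exact ⟨a, by rw [hb, smul_add, mul_smul]⟩
  · rintro ⟨a, rfl⟩
    exact ⟨⟨a, a * s, by rw [smul_add, mul_smul]⟩, by simp [hp, hn]⟩

variable [Finite K] [Module.Finite K V]

open Classical in
/-- The line through `p` and `n` has size `1` or is contained in `T`. -/
theorem ncard_line (h : IsSwitchingSet H p n T) {s : K} (hs : s ≠ 0) :
    (T ∩ pts (Submodule.span K {p, n})).ncard
      = 1 + Nat.card K * if p + s • n ∈ hat T then 1 else 0 := by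
  have := Fintype.ofFinite K
  have hH := h.finrank_solid
  have hL2 := finrank_span_pair h.linearIndependent
  obtain ⟨x, hx, hxL⟩ := exists_mem_notMem_of_finrank_lt
    (A := Submodule.span K {p, n}) (B := H) (by lia)
  have hli3 := linearIndependent_triple h.linearIndependent hxL
  have hW3 := finrank_span_triple hli3
  obtain ⟨u, hu, huW⟩ := exists_mem_notMem_of_finrank_lt
    (A := Submodule.span K {p, n, x}) (B := H) (by lia)
  have hli4 : LinearIndependent K ![u, x, p, n] := by
    refine linearIndependent_finCons.2 ⟨hli3, fun hc => huW ?_⟩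
    refine Submodule.span_mono ?_ hc
    rintro v ⟨i, rfl⟩
    fin_cases i <;> simp
  obtain ⟨c, hc⟩ := exists_functional_eq hli4 ![0, 1, 0, 0]
  obtain ⟨d, hd⟩ := exists_functional_eq hli4 ![1, 0, 0, 0]
  obtain ⟨f, hf⟩ := exists_functional_eq hli4 ![0, 0, -s, 1]
  have hcu : c u = 0 := hc 0
  have hcx : c x = 1 := hc 1
  have hcp : c p = 0 := hc 2
  have hcn : c n = 0 := hc 3
  have hdu : d u = 1 := hd 0
  have hdp : d p = 0 := hd 2
  have hdn : d n = 0 := hd 3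
  have hfp : f p = -s := hf 2
  have hfn : f n = 1 := hf 3
  have hL : H ⊓ LinearMap.ker c ⊓ LinearMap.ker d = Submodule.span K {p, n} := by
    refine (eq_of_le_of_finrank_eq (Submodule.span_le.2 ?_) ?_).symm
    · rintro v (rfl | rfl)
      · exact ⟨⟨h.mem_left, hcp⟩, hdp⟩
      · exact ⟨⟨h.mem_right, hcn⟩, hdn⟩
    · have h1 := finrank_inf_ker hx (f := c) (by simp [hcx])
      have h2 := finrank_inf_ker (U := H ⊓ LinearMap.ker c) (u := u) (f := d) ⟨hu, hcu⟩
        (by simp [hdu])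
      lia
  have pencil := ncard_pencil T H c d
  have pencil' := ncard_pencil T (H ⊓ LinearMap.ker f) c d
  have hfp0 : f p ≠ 0 := by simpa [hfp] using hs
  have hfn0 : f n ≠ 0 := by simp [hfn]
  have hplane : (T ∩ pts (H ⊓ LinearMap.ker f)).ncard = Nat.card K + 1 := by
    refine h.plane_of_notMem _ inf_le_left ?_ (fun hc => hfp0 hc.2) (fun hc => hfn0 hc.2)
    have := finrank_inf_ker h.mem_left hfp0
    lia
  have hc1 := h.ncard_inter_ker hcp hcn hfp0 hfn0
  -- Count `T` through the planes on `pn`, each governed by its trace on the plane `ker f`. These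
  -- traces form the pencil of lines of that plane through the point `p + s • n`.
  have ht : ∀ t : K, (T ∩ pts (H ⊓ LinearMap.ker (d - t • c))).ncard
      = 1 + Nat.card K
        * (T ∩ pts (H ⊓ LinearMap.ker (d - t • c) ⊓ LinearMap.ker f)).ncard := fun t =>
    h.ncard_inter_ker (by simp [hdp, hcp]) (by simp [hdn, hcn]) hfp0 hfn0
  simp only [inf_right_comm H (LinearMap.ker f)] at pencil'
  rw [inf_right_comm _ (LinearMap.ker f) (LinearMap.ker d), hL, span_inf_ker hfp hfn,
    ncard_inter_span_singleton (h.add_smul_ne_zero s), hplane] at pencil'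
  rw [hL, Set.inter_eq_self_of_subset_left h.subset, h.ncard_eq, hc1,
    Finset.sum_congr rfl (fun t _ => ht t), Finset.sum_add_distrib, ← Finset.mul_sum,
    Finset.sum_const, Finset.card_univ, ← Nat.card_eq_fintype_card, smul_eq_mul] at pencil
  refine Nat.eq_of_mul_eq_mul_left (Nat.card_pos (α := K)) ?_
  zify at pencil pencil' ⊢
  linear_combination (Nat.card K : ℤ) * pencil' - pencil

open Classical in
-- By `ncard_line`, all points of `pn` other than `p` and `n` lie in `T` or none does; comparing the
-- size of the line with the sum over its points gives the identity. Thus `T` contains `p` or `n`,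
-- and contains both only with the whole line.
theorem ncard_line_points (h : IsSwitchingSet H p n T) :
    (if p ∈ hat T then 1 else 0) + (if n ∈ hat T then 1 else 0)
      = 1 + if p + (1 : K) • n ∈ hat T then 1 else 0 := by
  have := Fintype.ofFinite K
  obtain ⟨a, hap, han⟩ := h.exists_functional 1 0
  obtain ⟨b, hbp, hbn⟩ := h.exists_functional 0 1
  have pencil := ncard_pencil T (Submodule.span K {p, n}) a b
  have hbot : Submodule.span K {p, n} ⊓ LinearMap.ker a ⊓ LinearMap.ker b = ⊥ := by
    rw [eq_bot_iff]
    rintro v ⟨⟨hv, hav⟩, hbv⟩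
    obtain ⟨r, s, rfl⟩ := Submodule.mem_span_pair.1 hv
    have hr : r = 0 := by simpa [hap, han] using hav
    have hs : s = 0 := by simpa [hbp, hbn] using hbv
    simp [hr, hs]
  have hempty : (T ∩ pts (⊥ : Submodule K V)) = ∅ := by
    rw [Set.eq_empty_iff_forall_notMem]
    rintro X ⟨-, hX⟩
    exact X.rep_nonzero (by simpa using mem_pts_iff.1 hX)
  have ha : Submodule.span K {p, n} ⊓ LinearMap.ker a = Submodule.span K {n} := by
    ext v
    simp only [Submodule.mem_inf, Submodule.mem_span_pair, Submodule.mem_span_singleton,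
      LinearMap.mem_ker]
    constructor
    · rintro ⟨⟨r, s, rfl⟩, hv⟩
      have : r = 0 := by simpa [hap, han] using hv
      exact ⟨s, by simp [this]⟩
    · rintro ⟨s, rfl⟩
      exact ⟨⟨0, s, by simp⟩, by simp [han]⟩
  have ht : ∀ t : K, Submodule.span K {p, n} ⊓ LinearMap.ker (b - t • a)
      = Submodule.span K {p + t • n} := fun t =>
    span_inf_ker (by simp [hap, hbp]) (by simp [han, hbn])
  rw [hbot, hempty, ha, ncard_inter_span_singleton h.right_ne_zero,
    Finset.sum_congr rfl (fun t _ => by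
      rw [ht, ncard_inter_span_singleton (h.add_smul_ne_zero t)]),
    ← Finset.add_sum_erase _ _ (Finset.mem_univ 0), zero_smul, add_zero] at pencil
  have hline : ∀ t ∈ Finset.univ.erase (0 : K),
      1 + Nat.card K * (if p + t • n ∈ hat T then 1 else 0)
        = (T ∩ pts (Submodule.span K {p, n})).ncard := fun t ht =>
    (h.ncard_line (Finset.ne_of_mem_erase ht)).symm
  have hsum := Finset.sum_congr rfl hline
  rw [Finset.sum_add_distrib, ← Finset.mul_sum, Finset.sum_const, Finset.sum_const,
    Finset.card_erase_of_mem (Finset.mem_univ _), Finset.card_univ, ← Nat.card_eq_fintype_card,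
    smul_eq_mul, smul_eq_mul] at hsum
  have hone := h.ncard_line (one_ne_zero (α := K))
  refine Nat.eq_of_mul_eq_mul_left (Nat.card_pos (α := K)) ?_
  rw [Set.ncard_empty] at pencil
  zify [cast_card_sub_one] at pencil hsum hone ⊢
  linear_combination (Nat.card K : ℤ) * pencil - hsum + hone

theorem pts_line_subset (h : IsSwitchingSet H p n T)
    (h1 : 1 < (T ∩ pts (Submodule.span K {p, n})).ncard) : pts (Submodule.span K {p, n}) ⊆ T := by
  classical
  have := finite_projectivization (K := K) (V := V)
  have h2 := h.ncard_line (one_ne_zero (α := K))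
  have h3 := ncard_pts_line (finrank_span_pair h.linearIndependent)
  have h4 : T ∩ pts (Submodule.span K {p, n}) = pts (Submodule.span K {p, n}) := by
    refine Set.eq_of_subset_of_ncard_le Set.inter_subset_right ?_ (Set.toFinite _)
    split_ifs at h2 <;> lia
  exact Set.inter_eq_right.1 h4

/-- In each plane through `p` and `n`, the set `T` is ruled by lines through `p` or by lines
through `n`. -/
theorem isRuledAt_or (h : IsSwitchingSet H p n T) {x : V} (hx : x ∈ H)
    (hxL : x ∉ Submodule.span K {p, n}) : IsRuledAt T p n x ∨ IsRuledAt T n p x := by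
  classical
  by_contra! hc
  unfold IsRuledAt at hc
  push Not at hc
  obtain ⟨⟨a₁, a₁', b₁, h₁, h₁'⟩, b₂, b₂', a₂, h₂, h₂'⟩ := hc
  rw [add_right_comm] at h₂ h₂'
  set A : K → ℤ := fun b => ((T ∩ pts (Submodule.span K {p, x + b • n})).ncard : ℤ)
  set B : K → ℤ := fun a => ((T ∩ pts (Submodule.span K {n, x + a • p})).ncard : ℤ)
  set F : K → K → ℤ := fun a b => if x + a • p + b • n ∈ hat T then 1 else 0 with hF
  have key : ∀ a b, (Nat.card K : ℤ) * (A b + B a) + 1 = Nat.card K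
      + (T ∩ pts (Submodule.span K {p, n, x})).ncard + Nat.card K ^ 2 * F a b := by
    intro a b
    have hL : a • p + b • n ∈ Submodule.span K {p, n} := Submodule.mem_span_pair.2 ⟨a, b, rfl⟩
    have h1 := h.ncard_add_ncard (x := x + a • p + b • n)
      (by rw [add_assoc]; exact H.add_mem hx (h.span_le hL))
      (by rw [add_assoc]; exact fun hc => hxL ((Submodule.add_mem_iff_left _ hL).1 hc))
    have h2 : Submodule.span K {p, n, x + a • p + b • n} = Submodule.span K {p, n, x} := by
      ext v
      simp only [Submodule.mem_span_triple]
      constructor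
      · rintro ⟨r, s, t, rfl⟩
        exact ⟨r + t * a, s + t * b, t, by module⟩
      · rintro ⟨r, s, t, rfl⟩
        exact ⟨r - t * a, s - t * b, t, by module⟩
    rw [h2, add_right_comm x, span_add_smul_left, add_right_comm x, span_add_smul_left] at h1
    zify at h1
    exact h1
  have hq : (1 : ℤ) < Nat.card K := by exact_mod_cast one_lt_card_field (K := K)
  have key' : ∀ a b a' b', A b + B a - A b' - B a' = Nat.card K * (F a b - F a' b') := by
    intro a b a' b'
    refine mul_left_cancel₀ (by lia : (Nat.card K : ℤ) ≠ 0) ?_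
    linear_combination key a b - key a' b'
  have e₁ := key' a₁ b₁ a₁' b₁
  have e₂ := key' a₂ b₂ a₂ b₂'
  -- The first failure forces `B a₁ - B a₁' = q` and the second `A b₂ - A b₂' = q`. Their sum `2q`
  -- would be `q` times a difference of two indicators.
  have e₃ := key' a₁ b₂ a₁' b₂'
  simp only [hF, if_pos h₁, if_neg h₁', if_pos h₂, if_neg h₂'] at e₁ e₂ e₃
  split_ifs at e₃ <;> lia

end IsSwitchingSet
end Split

/-! ### Splitting the switching set, divisibility, and the four cases. -/

section Main

variable {K V : Type*} [Field K] [AddCommGroup V] [Module K V]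

theorem mem_hat_sep {T : Set (ℙ K V)} {φ : V → Prop}
    (hφ : ∀ (c : K) (v : V), c ≠ 0 → φ v → φ (c • v)) {v : V} :
    v ∈ hat {X | X ∈ T ∧ φ X.rep} ↔ v ∈ hat T ∧ φ v := by
  have key : ∀ hv : v ≠ 0, φ (Projectivization.mk K v hv).rep ↔ φ v := by
    intro hv
    obtain ⟨a, ha⟩ := Projectivization.exists_smul_eq_mk_rep K v hv
    rw [← ha, Units.smul_def]
    refine ⟨fun h => ?_, hφ a v a.ne_zero⟩
    have := hφ (a : K)⁻¹ _ (inv_ne_zero a.ne_zero) h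
    rwa [smul_smul, inv_mul_cancel₀ a.ne_zero, one_smul] at this
  exact ⟨fun ⟨hv, h1, h2⟩ => ⟨⟨hv, h1⟩, (key hv).1 h2⟩,
    fun ⟨⟨hv, h1⟩, h2⟩ => ⟨hv, h1, (key hv).2 h2⟩⟩

/-- Together with `IsRuledAt.add`: being ruled belongs to the plane spanned by `p`, `n`, `x`, not to
the choice of `x` in it. -/
theorem IsRuledAt.smul {T : Set (ℙ K V)} {p n x : V} (h : IsRuledAt T p n x) {c : K}
    (hc : c ≠ 0) : IsRuledAt T p n (c • x) := by
  have e : ∀ a b : K, c • x + a • p + b • n = c • (x + (c⁻¹ * a) • p + (c⁻¹ * b) • n) := by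
    intro a b
    simp only [smul_add, smul_smul, mul_inv_cancel_left₀ hc]
  intro a a' b
  rw [e, e, smul_mem_hat hc, smul_mem_hat hc]
  exact h _ _ _

theorem IsRuledAt.add {T : Set (ℙ K V)} {p n x : V} (h : IsRuledAt T p n x) (r s : K) :
    IsRuledAt T p n (x + r • p + s • n) := by
  have e : ∀ a b : K, x + r • p + s • n + a • p + b • n = x + (r + a) • p + (s + b) • n := by
    intro a b
    module
  intro a a' b
  rw [e, e]
  exact h _ _ _

/-- A decomposition of `T`, outside the line through `p` and `n`, into a union `T₁` of lines through
`p` and a union `T₂` of lines through `n`. -/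
structure IsPuncturedSplit (p n : V) (T T₁ T₂ : Set (ℙ K V)) : Prop where
  left : IsPunctured p T₁
  right : IsPunctured n T₂
  left_subset : T₁ ⊆ T
  right_subset : T₂ ⊆ T
  disjoint : Disjoint T₁ T₂
  disjoint_left : Disjoint T₁ (pts (Submodule.span K {p, n}))
  disjoint_right : Disjoint T₂ (pts (Submodule.span K {p, n}))
  subset : T ⊆ T₁ ∪ T₂ ∪ pts (Submodule.span K {p, n})

theorem IsPuncturedSplit.symm {p n : V} {T T₁ T₂ : Set (ℙ K V)}
    (h : IsPuncturedSplit p n T T₁ T₂) : IsPuncturedSplit n p T T₂ T₁ :=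
  { left := h.right
    right := h.left
    left_subset := h.right_subset
    right_subset := h.left_subset
    disjoint := h.disjoint.symm
    disjoint_left := by rw [Set.pair_comm]; exact h.disjoint_right
    disjoint_right := by rw [Set.pair_comm]; exact h.disjoint_left
    subset := by rw [Set.pair_comm, Set.union_comm T₂]; exact h.subset }

variable [Finite K] [Module.Finite K V] {H : Submodule K V} {T T₁ T₂ : Set (ℙ K V)}

/-- Send the points of each plane on `pn` to `T₁` if the plane is ruled from `p`, otherwise to `T₂`.
A plane ruled in both ways goes to `T₁`, which keeps the parts disjoint. -/
theorem IsSwitchingSet.exists_split {p n : V} (h : IsSwitchingSet H p n T) :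
    ∃ T₁ T₂, IsPuncturedSplit p n T T₁ T₂ := by
  set L := Submodule.span K {p, n} with hL
  have hsub : ∀ (c : K) (v : V), c ≠ 0 → v ∉ L → c • v ∉ L := fun c v hc hv h =>
    hv ((Submodule.smul_mem_iff _ hc).1 h)
  have mem₁ : ∀ v, v ∈ hat {X | X ∈ T ∧ X.rep ∉ L ∧ IsRuledAt T p n X.rep} ↔
      v ∈ hat T ∧ v ∉ L ∧ IsRuledAt T p n v := fun v =>
    mem_hat_sep (φ := fun v => v ∉ L ∧ IsRuledAt T p n v) fun c v hc hv =>
      ⟨hsub c v hc hv.1, hv.2.smul hc⟩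
  have mem₂ : ∀ v, v ∈ hat {X | X ∈ T ∧ X.rep ∉ L ∧ ¬ IsRuledAt T p n X.rep} ↔
      v ∈ hat T ∧ v ∉ L ∧ ¬ IsRuledAt T p n v := fun v =>
    mem_hat_sep (φ := fun v => v ∉ L ∧ ¬ IsRuledAt T p n v) fun c v hc hv =>
      ⟨hsub c v hc hv.1, fun h => hv.2 (by
      have := h.smul (inv_ne_zero hc)
      rwa [smul_smul, inv_mul_cancel₀ hc, one_smul] at this)⟩
  have hpL : p ∈ L := Submodule.subset_span (by simp)
  have hnL : n ∈ L := Submodule.subset_span (by simp)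
  refine ⟨{X | X ∈ T ∧ X.rep ∉ L ∧ IsRuledAt T p n X.rep},
    {X | X ∈ T ∧ X.rep ∉ L ∧ ¬ IsRuledAt T p n X.rep}, ?_⟩
  refine ⟨?_, ?_, fun X hX => hX.1, fun X hX => hX.1, ?_, ?_, ?_, ?_⟩
  · intro v hv t
    rw [mem₁] at hv ⊢
    obtain ⟨h1, h2, h3⟩ := hv
    refine ⟨?_, fun hc => h2 ((Submodule.add_mem_iff_left _ (L.smul_mem t hpL)).1 hc), ?_⟩
    · simpa using h3 0 t 0 (by simpa using h1)
    · simpa using h3.add t 0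
  · intro v hv t
    rw [mem₂] at hv ⊢
    obtain ⟨h1, h2, h3⟩ := hv
    refine ⟨?_, fun hc => h2 ((Submodule.add_mem_iff_left _ (L.smul_mem t hnL)).1 hc), ?_⟩
    · have h4 := (h.isRuledAt_or (mem_of_mem_hat h.subset h1) h2).resolve_left h3
      simpa using h4 0 t 0 (by simpa using h1)
    · intro hc
      apply h3
      simpa using hc.add 0 (-t)
  · exact Set.disjoint_left.2 fun X h1 h2 => h2.2.2 h1.2.2
  · exact Set.disjoint_left.2 fun X h1 h2 => h1.2.1 (mem_pts_iff.1 h2)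
  · exact Set.disjoint_left.2 fun X h1 h2 => h1.2.1 (mem_pts_iff.1 h2)
  · intro X hX
    by_cases hXL : X.rep ∈ L
    · exact Or.inr (mem_pts_iff.2 hXL)
    · by_cases hr : IsRuledAt T p n X.rep
      · exact Or.inl (Or.inl ⟨hX, hXL, hr⟩)
      · exact Or.inl (Or.inr ⟨hX, hXL, hr⟩)

theorem IsPuncturedSplit.ncard_inter {p n : V} (h : IsPuncturedSplit p n T T₁ T₂)
    (α : Submodule K V) : (T ∩ pts α).ncard = (T₁ ∩ pts α).ncard + (T₂ ∩ pts α).ncard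
      + (T ∩ pts (Submodule.span K {p, n} ⊓ α)).ncard := by
  have := finite_projectivization (K := K) (V := V)
  rw [← Set.ncard_union_eq (h.disjoint.mono Set.inter_subset_left Set.inter_subset_left),
    ← Set.union_inter_distrib_right, pts_inf, ← Set.ncard_union_eq]
  · congr 1
    ext X
    have h1 := @h.subset X
    have h2 := @h.left_subset X
    have h3 := @h.right_subset X
    simp only [Set.mem_union, Set.mem_inter_iff] at *
    tauto
  · refine Set.disjoint_left.2 fun X h1 h2 => ?_
    rcases h1.1 with h3 | h3
    · exact Set.disjoint_left.1 h.disjoint_left h3 h2.2.1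
    · exact Set.disjoint_left.1 h.disjoint_right h3 h2.2.1

open Classical in
/-- A divisibility condition, from the section of `T` by a plane through `p` not containing `n`. -/
theorem IsPuncturedSplit.exists_ncard_eq {p n : V} (hT : IsSwitchingSet H p n T)
    (h : IsPuncturedSplit p n T T₁ T₂) {μ : Submodule K V} (hμ : μ ≤ H) (hμ3 : finrank K μ = 3)
    (hpμ : p ∉ μ) (hnμ : n ∉ μ) :
    ∃ k j : ℕ, Nat.card K * k + (T₂ ∩ pts μ).ncard + (if p ∈ hat T then 1 else 0)
      = 1 + Nat.card K * j := by
  have hH := hT.finrank_solid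
  -- The value `-0` matches `span_inf_ker` at `s = 0`, where the plane meets `pn` in `p` itself.
  obtain ⟨f, hfp, hfn⟩ := hT.symm.exists_functional 1 (-0)
  obtain ⟨hfp, hfn⟩ : f p = -0 ∧ f n = 1 := ⟨hfn, hfp⟩
  have hα3 : finrank K ↥(H ⊓ LinearMap.ker f) = 3 := by
    have := finrank_inf_ker hT.mem_right (f := f) (by simp [hfn])
    lia
  have hpα : p ∈ H ⊓ LinearMap.ker f := ⟨hT.mem_left, by simpa using hfp⟩
  have hnα : n ∉ H ⊓ LinearMap.ker f := fun hc => by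
    have : f n = 0 := hc.2
    simp [hfn] at this
  have hc := h.ncard_inter (H ⊓ LinearMap.ker f)
  rw [← inf_assoc, inf_eq_left.2 hT.span_le, IsSwitchingSet.span_inf_ker hfp hfn, zero_smul,
    add_zero, ncard_inter_span_singleton hT.left_ne_zero] at hc
  have h1 := (h.left.inter_pts hpα).card_mul_ncard
    (Set.inter_subset_left.trans (h.left_subset.trans hT.subset)) hμ (by lia) hT.mem_left hpμ
  have hsub := h.right_subset.trans hT.subset
  have h2 := h.right.card_mul_ncard hsub hμ (by lia) hT.mem_right hnμ
  have h3 := h.right.card_mul_ncard hsub inf_le_left (by lia) hT.mem_right hnα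
  rw [← h3] at h2
  rw [← h1, ← Nat.eq_of_mul_eq_mul_left Nat.card_pos h2] at hc
  refine ⟨(T₁ ∩ pts (H ⊓ LinearMap.ker f) ∩ pts μ).ncard, ?_⟩
  -- All three plane sizes are `1` modulo `q`, the `T₁` part is a multiple of `q`, and the `T₂` part
  -- has the same size here as in `μ`.
  rcases hT.plane _ inf_le_left hα3 with h4 | h4 | h4
  · exact ⟨0, by lia⟩
  · exact ⟨1, by lia⟩
  · exact ⟨2, by lia⟩

/-- The base of a truncated cone contained in a switching set is an arc. -/
theorem IsSwitchingSet.isArc {P N : ℙ K V} (hT : IsSwitchingSet H P.rep N.rep T)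
    {μ : Submodule K V} (hμ : μ ≤ H) (hμ3 : finrank K μ = 3) (hP : P ∉ pts μ) {A : Set (ℙ K V)}
    (hA : A ⊆ pts μ) (hAT : truncatedCone P A ⊆ T) : IsArc μ A.ncard A := by
  have := finite_projectivization (K := K) (V := V)
  refine ⟨hμ3, hA, rfl, fun l hl => ?_⟩
  have hq := one_lt_card_field (K := K)
  by_cases hle : l ≤ μ
  · have hPl : P.rep ∉ l := fun hc => hP (mem_pts_iff.2 (hle hc))
    have hPH : P.submodule ≤ H := by
      rw [Projectivization.submodule_eq, Submodule.span_singleton_le_iff_mem]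
      exact hT.mem_left
    have hPα : P.rep ∈ l ⊔ P.submodule :=
      (le_sup_right : P.submodule ≤ l ⊔ P.submodule) (by
        rw [Projectivization.submodule_eq]
        exact Submodule.mem_span_singleton_self _)
    have hα3 : finrank K ↥(l ⊔ P.submodule) = 3 := by
      have h1 := Submodule.finrank_sup_add_finrank_inf_eq l P.submodule
      have h2 : l ⊓ P.submodule = ⊥ := by
        rw [eq_bot_iff]
        rintro v ⟨hv, hv'⟩
        rw [Projectivization.submodule_eq] at hv'
        obtain ⟨c, rfl⟩ := Submodule.mem_span_singleton.1 hv'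
        by_cases hc : c = 0
        · simp [hc]
        · exact absurd ((Submodule.smul_mem_iff _ hc).1 hv) hPl
      rw [h2, finrank_bot, hl, P.finrank_submodule] at h1
      exact h1
    have base : IsConeBase H P μ A :=
      ⟨hT.finrank_solid, mem_pts_iff.2 hT.mem_left, hμ, hμ3, hP, hA⟩
    have h1 := base.ncard_truncatedCone_inter_of_mem hPα
    have h2 : (truncatedCone P A ∩ pts (l ⊔ P.submodule)).ncard
        ≤ (T ∩ pts (l ⊔ P.submodule)).ncard :=
      Set.ncard_le_ncard (Set.inter_subset_inter_left _ hAT) (Set.toFinite _)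
    have h3 : (A ∩ pts l).ncard ≤ (A ∩ pts (l ⊔ P.submodule)).ncard :=
      Set.ncard_le_ncard (Set.inter_subset_inter_right _ fun X hX =>
        le_trans (show X.submodule ≤ l from hX) le_sup_left) (Set.toFinite _)
    have h4 := hT.plane _ (sup_le (hle.trans hμ) hPH) hα3
    by_contra! hc
    -- Three base points on `l` would put `3q` points of `T` in the plane joining `l` to `P`,
    -- exceeding `2q + 1` since `q ≥ 2`.
    have h5 : Nat.card K * 3 ≤ Nat.card K * (A ∩ pts (l ⊔ P.submodule)).ncard :=
      Nat.mul_le_mul_left _ (by lia)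
    lia
  · have h1 : finrank K ↥(l ⊓ μ) ≤ 2 := hl ▸ Submodule.finrank_mono inf_le_left
    have h2 : finrank K ↥(l ⊓ μ) ≠ 2 := fun hc =>
      hle (inf_eq_left.1 (eq_of_le_of_finrank_eq (inf_le_left : l ⊓ μ ≤ l) (by rw [hc, hl])))
    have h3 : (A ∩ pts l).ncard ≤ (pts (l ⊓ μ)).ncard := by
      rw [pts_inf]
      exact Set.ncard_le_ncard (fun X hX => ⟨hX.2, hA hX.1⟩) (Set.toFinite _)
    have h4 : (pts (l ⊓ μ)).ncard ≤ 1 := by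
      have h5 := ncard_pts (l ⊓ μ)
      obtain h6 | h6 : finrank K ↥(l ⊓ μ) = 0 ∨ finrank K ↥(l ⊓ μ) = 1 := by lia
      · rw [h6, pow_zero, Nat.add_eq_right, Nat.mul_eq_zero] at h5
        lia
      · exact (ncard_pts_point h6).le
    lia

/-- With `T₂` empty, only `pn` could prevent `T` from being a cone at `P`. As `P ∈ T`, a second
point of `T` on `pn` brings in the whole line. -/
theorem IsPuncturedSplit.isOvalCone {P N : ℙ K V} (hT : IsSwitchingSet H P.rep N.rep T)
    (h : IsPuncturedSplit P.rep N.rep T T₁ T₂) {μ : Submodule K V} (hμ : μ ≤ H)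
    (hμ3 : finrank K μ = 3) (hPμ : P.rep ∉ μ) (hNμ : N.rep ∉ μ) (hPT : P ∈ T)
    (h₂ : (T₂ ∩ pts μ).ncard = 0) : IsOvalCone H P T := by
  have := finite_projectivization (K := K) (V := V)
  have hH := hT.finrank_solid
  have hPμ' : P ∉ pts μ := fun hc => hPμ (mem_pts_iff.1 hc)
  have hT₂ : T₂ = ∅ := by
    have := h.right.card_mul_ncard (h.right_subset.trans hT.subset) hμ (by lia) hT.mem_right hNμ
    rw [h₂, mul_zero, eq_comm, Set.ncard_eq_zero] at this
    exact this
  have hPL : P ∈ pts (Submodule.span K {P.rep, N.rep}) :=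
    mem_pts_iff.2 (Submodule.subset_span (by simp))
  have hpunct : IsPunctured P.rep (T \ {P}) := by
    rintro v ⟨hv, hvT, hvP⟩ t
    have hne : ∀ (hw : v + t • P.rep ≠ 0), Projectivization.mk K _ hw ≠ P := by
      intro hw hc
      obtain ⟨a, ha⟩ := (Projectivization.mk_eq_mk_iff' K _ _ hw P.rep_nonzero).1
        (hc.trans P.mk_rep.symm)
      apply hvP
      rw [Set.mem_singleton_iff, ← P.mk_rep, Projectivization.mk_eq_mk_iff']
      exact ⟨a - t, by rw [sub_smul, ha, add_sub_cancel_right]⟩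
    have hw : v + t • P.rep ≠ 0 := by
      intro h0
      apply hvP
      rw [Set.mem_singleton_iff, ← P.mk_rep, Projectivization.mk_eq_mk_iff']
      exact ⟨-t, by rw [neg_smul, ← eq_neg_of_add_eq_zero_left h0]⟩
    refine ⟨hw, ?_, hne hw⟩
    rcases h.subset hvT with (h1 | h1) | h1
    · obtain ⟨_, h2⟩ := h.left v ⟨hv, h1⟩ t
      exact h.left_subset h2
    · rw [hT₂] at h1
      exact absurd h1 (Set.notMem_empty _)
    · have h3 : 1 < (T ∩ pts (Submodule.span K {P.rep, N.rep})).ncard :=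
        (Set.one_lt_ncard (Set.toFinite _)).2 ⟨_, ⟨hvT, h1⟩, P, ⟨hPT, hPL⟩, hvP⟩
      refine hT.pts_line_subset h3 ((mk_mem_pts hw).2 ?_)
      exact Submodule.add_mem _ ((mk_mem_pts hv).1 h1)
        (Submodule.smul_mem _ _ (mem_pts_iff.1 hPL))
  have hcone := hpunct.eq_truncatedCone (Set.sdiff_subset.trans hT.subset) hμ (by lia)
    (mem_pts_iff.2 hT.mem_left) hPμ'
  have hbase : T \ {P} ∩ pts μ = T ∩ pts μ := by
    ext X
    exact ⟨fun hX => ⟨hX.1.1, hX.2⟩, fun hX => ⟨⟨hX.1, fun hc => hPμ' (by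
      rw [← Set.mem_singleton_iff.1 hc]
      exact hX.2)⟩, hX.2⟩⟩
  rw [hbase] at hcone
  have hcard := hT.plane_of_notMem μ hμ hμ3 hPμ hNμ
  refine ⟨μ, T ∩ pts μ, hμ, hPμ', ?_, ?_⟩
  · have := hT.isArc hμ hμ3 hPμ' (A := T ∩ pts μ) Set.inter_subset_right
      (by rw [← hcone]; exact Set.sdiff_subset)
    rwa [hcard] at this
  · rw [cone_eq_insert (Set.nonempty_of_ncard_ne_zero (by lia)), ← hcone,
      Set.insert_sdiff_singleton, Set.insert_eq_of_mem hPT]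

/-- Here `T₂` is a line through `N` with `N` removed. Since `N ∈ T` and `P ∉ T`, the line `pn`
contributes just `N`, which completes it. -/
theorem IsPuncturedSplit.isTruncatedArcConeWithLine {P N : ℙ K V}
    (hT : IsSwitchingSet H P.rep N.rep T) (h : IsPuncturedSplit P.rep N.rep T T₁ T₂)
    {μ : Submodule K V} (hμ : μ ≤ H) (hμ3 : finrank K μ = 3) (hPμ : P.rep ∉ μ) (hNμ : N.rep ∉ μ)
    (hPT : P ∉ T) (hNT : N ∈ T) (h₁ : (T₁ ∩ pts μ).ncard = Nat.card K)
    (h₂ : (T₂ ∩ pts μ).ncard = 1) : IsTruncatedArcConeWithLine H P N T := by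
  have := finite_projectivization (K := K) (V := V)
  have hH := hT.finrank_solid
  have hPμ' : P ∉ pts μ := fun hc => hPμ (mem_pts_iff.1 hc)
  have hNμ' : N ∉ pts μ := fun hc => hNμ (mem_pts_iff.1 hc)
  have hPL : P ∈ pts (Submodule.span K {P.rep, N.rep}) :=
    mem_pts_iff.2 (Submodule.subset_span (by simp))
  have hNL : N ∈ pts (Submodule.span K {P.rep, N.rep}) :=
    mem_pts_iff.2 (Submodule.subset_span (by simp))
  have e₁ := h.left.eq_truncatedCone (h.left_subset.trans hT.subset) hμ (by lia)
    (mem_pts_iff.2 hT.mem_left) hPμ'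
  have e₂ := h.right.eq_truncatedCone (h.right_subset.trans hT.subset) hμ (by lia)
    (mem_pts_iff.2 hT.mem_right) hNμ'
  obtain ⟨b, hb⟩ := Set.ncard_eq_one.1 h₂
  have hbm : b ∈ T₂ ∩ pts μ := by rw [hb]; rfl
  have hbL : b ∉ pts (Submodule.span K {P.rep, N.rep}) :=
    Set.disjoint_left.1 h.disjoint_right hbm.1
  have hline : pts (N.submodule ⊔ b.submodule) = insert N T₂ := by
    rw [e₂, hb, ← cone_eq_insert (Set.singleton_nonempty b)]
    ext X
    simp [cone]
  have hdisj : Disjoint T₁ (insert N T₂) := by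
    rw [Set.disjoint_insert_right]
    exact ⟨fun hc => Set.disjoint_left.1 h.disjoint_left hc hNL, h.disjoint⟩
  have hbl : b ∈ pts (N.submodule ⊔ b.submodule) :=
    (show b.submodule ≤ _ from le_sup_right)
  refine ⟨μ, T₁ ∩ pts μ, N.submodule ⊔ b.submodule, hμ, hPμ', ?_, ?_, ?_, ?_, ?_, ?_, ?_⟩
  · have := hT.isArc hμ hμ3 hPμ' (A := T₁ ∩ pts μ) Set.inter_subset_right
      (by rw [← e₁]; exact h.left_subset)
    rwa [h₁] at this
  · rw [submodule_sup_eq_span]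
    refine Submodule.span_le.2 ?_
    rintro v (rfl | rfl)
    · exact hT.mem_right
    · exact hμ (mem_pts_iff.1 hbm.2)
  · rw [submodule_sup_eq_span]
    refine finrank_span_pair ((LinearIndependent.pair_iff' N.rep_nonzero).2 fun a ha => ?_)
    apply hbL
    rw [mem_pts_iff, ← ha]
    exact Submodule.smul_mem _ _ (mem_pts_iff.1 hNL)
  · exact (show N.submodule ≤ _ from le_sup_left)
  · intro hc
    apply hbL
    rwa [hc, submodule_sup_eq_span] at hbl
  · rwa [← e₁, hline]
  · rw [← e₁, hline]
    refine Set.Subset.antisymm (fun X hX => ?_)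
      (Set.union_subset h.left_subset (Set.insert_subset hNT h.right_subset))
    rcases h.subset hX with (h1 | h1) | h1
    · exact Or.inl h1
    · exact Or.inr (Or.inr h1)
    · refine Or.inr (Or.inl ?_)
      by_contra hXN
      have h3 : 1 < (T ∩ pts (Submodule.span K {P.rep, N.rep})).ncard :=
        (Set.one_lt_ncard (Set.toFinite _)).2 ⟨_, ⟨hX, h1⟩, N, ⟨hNT, hNL⟩, hXN⟩
      exact hPT (hT.pts_line_subset h3 hPL)

theorem IsSwitchingSet.classification {P N : ℙ K V} (hT : IsSwitchingSet H P.rep N.rep T) :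
    IsOvalCone H P T ∨ IsOvalCone H N T ∨ IsTruncatedArcConeWithLine H P N T ∨
      IsTruncatedArcConeWithLine H N P T := by
  classical
  have hH := hT.finrank_solid
  obtain ⟨T₁, T₂, h⟩ := hT.exists_split
  -- These values make the plane `H ⊓ ker f` miss both vertices and meet `pn` in `p + n`, the point
  -- occurring in `ncard_line_points`.
  obtain ⟨f, hfp, hfn⟩ := hT.exists_functional (-1) 1
  have hμ3 : finrank K ↥(H ⊓ LinearMap.ker f) = 3 := by
    have := finrank_inf_ker hT.mem_right (f := f) (by simp [hfn])
    lia
  have hPμ : P.rep ∉ H ⊓ LinearMap.ker f := fun hc => by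
    have : f P.rep = 0 := hc.2
    simp [hfp] at this
  have hNμ : N.rep ∉ H ⊓ LinearMap.ker f := fun hc => by
    have : f N.rep = 0 := hc.2
    simp [hfn] at this
  have hμ : H ⊓ LinearMap.ker f ≤ H := inf_le_left
  have hsum := h.ncard_inter (H ⊓ LinearMap.ker f)
  rw [hT.plane_of_notMem _ hμ hμ3 hPμ hNμ, ← inf_assoc, inf_eq_left.2 hT.span_le,
    span_inf_ker hfp hfn, ncard_inter_span_singleton (hT.add_smul_ne_zero 1)] at hsum
  have hpts := hT.ncard_line_points
  obtain ⟨k, j, hk⟩ := h.exists_ncard_eq hT hμ hμ3 hPμ hNμ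
  obtain ⟨k', j', hk'⟩ := h.symm.exists_ncard_eq hT.symm hμ hμ3 hNμ hPμ
  have hq := one_lt_card_field (K := K)
  have c1 := h.isOvalCone hT hμ hμ3 hPμ hNμ
  have c2 := h.symm.isOvalCone hT.symm hμ hμ3 hNμ hPμ
  have c3 := h.isTruncatedArcConeWithLine hT hμ hμ3 hPμ hNμ
  have c4 := h.symm.isTruncatedArcConeWithLine hT.symm hμ hμ3 hNμ hPμ
  simp only [rep_mem_hat] at *
  generalize (T₁ ∩ pts (H ⊓ LinearMap.ker f)).ncard = A at *
  generalize (T₂ ∩ pts (H ⊓ LinearMap.ker f)).ncard = B at *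
  generalize (if P.rep + (1 : K) • N.rep ∈ hat T then 1 else 0) = e at hpts hsum
  -- A multiple of `q` that is at most `q + 1` is `0` or `q`, because `2q > q + 1`.
  have small : ∀ x i i' : ℕ, x ≤ Nat.card K + 1 → Nat.card K * i + x = Nat.card K * i' →
      x = 0 ∨ x = Nat.card K := by
    intro x i i' hx hxi
    have hdvd : Nat.card K ∣ x :=
      (Nat.dvd_add_right (Dvd.intro i rfl)).1 (hxi ▸ Dvd.intro i' rfl)
    obtain ⟨c, rfl⟩ := hdvd
    have : c < 2 := by
      by_contra! hc
      have := Nat.mul_le_mul_left (Nat.card K) hc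
      lia
    interval_cases c <;> simp
  by_cases hP : P ∈ T <;> by_cases hN : N ∈ T
  · simp only [hP, hN, if_true] at hpts hk hk'
    rcases small B k j (by lia) (by lia) with hB | hB
    · exact Or.inl (c1 hP hB)
    · exact Or.inr (Or.inl (c2 hN (by lia)))
  · simp only [hP, hN, if_true, if_false] at hpts hk hk'
    rcases small B k j (by lia) (by lia) with hB | hB
    · exact Or.inl (c1 hP hB)
    · exact Or.inr (Or.inr (Or.inr (c4 hN hP hB (by lia))))
  · simp only [hP, hN, if_true, if_false, zero_add] at hpts hk hk'
    rcases small A k' j' (by lia) (by lia) with hA | hA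
    · exact Or.inr (Or.inl (c2 hN hA))
    · exact Or.inr (Or.inr (Or.inl (c3 hP hN hA (by lia))))
  · simp only [hP, hN, if_false] at hpts
    lia

end Main
end QuasiPolar

theorem mainTheorem7 {K V : Type*} [Field K] [Finite K] [AddCommGroup V] [Module K V]
    (hq : Even (Nat.card K)) (hV : Module.finrank K V = 5)
    (Q : QuadraticForm K V) (hQ : QuasiPolar.Nonsingular Q)
    (N : ℙ K V) (hN : QuasiPolar.IsNucleus (QuasiPolar.quadric Q) N)
    (H : Submodule K V) (P : ℙ K V) (hH : QuasiPolar.IsSingularSolid Q H P)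
    (S : Set (ℙ K V)) (hS : QuasiPolar.IsSwitching (QuasiPolar.quadric Q) H S) :
    (QuasiPolar.IsParabolicQuasiQuadric S ∧ S.ncard = (QuasiPolar.quadric Q).ncard) ↔
      (QuasiPolar.IsOvalCone H P (S ∩ QuasiPolar.pts H) ∨
        QuasiPolar.IsOvalCone H N (S ∩ QuasiPolar.pts H) ∨
        QuasiPolar.IsTruncatedArcConeWithLine H P N (S ∩ QuasiPolar.pts H) ∨
        QuasiPolar.IsTruncatedArcConeWithLine H N P (S ∩ QuasiPolar.pts H)) := by
  have := QuasiPolar.charP_two_of_even_card hq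
  have : Module.Finite K V := Module.finite_of_finrank_pos (by rw [hV]; norm_num)
  have h := hH.isTangentSolid hV hQ hN
  -- All that is kept of the switching is that nothing changes off `H`.
  have hS' : S \ QuasiPolar.pts H = QuasiPolar.quadric Q \ QuasiPolar.pts H := by
    obtain ⟨R, R', hR, hR', rfl⟩ := hS
    ext X
    have h1 := @hR X
    have h2 := @hR' X
    simp only [Set.mem_sdiff, Set.mem_union]
    tauto
  rw [h.isParabolicQuasiQuadric_and_ncard_iff hS']
  have hPH := QuasiPolar.mem_pts_iff.2 h.vertex_mem
  have hNH := QuasiPolar.mem_pts_iff.2 h.nucleus_mem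
  constructor
  · intro hT
    exact QuasiPolar.IsSwitchingSet.classification
      { hT with
        finrank_solid := h.finrank_solid
        linearIndependent := h.linearIndependent
        mem_left := h.vertex_mem
        mem_right := h.nucleus_mem }
  · rintro (hT | hT | hT | hT)
    · exact hT.hasPlaneSizes h.finrank_solid hPH _
    · exact (hT.hasPlaneSizes h.finrank_solid hNH _).symm
    · exact hT.hasPlaneSizes h.finrank_solid hPH h.linearIndependent
    · exact (hT.hasPlaneSizes h.finrank_solid hNH
        (LinearIndependent.pair_symm_iff.1 h.linearIndependent)).symm
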